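/- **Setting.** Let $p_n$ be the $n$-th prime number ($n\ge 1$). Let $g(n)$ and $f(j,n)$ ($1\le j\le g(n)$) be positive integers and $a_n^{(j)}$ complex numbers such that, for some constants $C_1>0$ and $\alpha,\beta\ge 0$, $g(n)\le C_1p_n^{\alpha}$ and $|a_n^{(j)}|\le p_n^{\beta}$ for all $n$ and $j$. Put $$A_n(X)=\prod_{j=1}^{g(n)}\bigl(1-a_n^{(j)}X^{f(j,n)}\bigr),\qquad \varphi(s)=\prod_{n=1}^{\infty}A_n(p_n^{-s})^{-1}\quad(\Re s>\alpha+\beta+1).$$ Let $\sigma_0$ be a real number with $\alpha+\beta+\tfrac12\le\sigma_0<\alpha+\beta+1$, and suppose that $\varphi\in\mathcal M$, that is: (i) $\varphi$ can be continued meromorphically to the closed half-plane $\Re s\ge\sigma_0$ (meromorphic at each of its points, including those on the line $\Re s=\sigma_0$), and all poles in it lie in a compact subset of $\{s:\Re s>\sigma_0\}$; (ii) there is a constant $C>0$ such that $\varphi(\sigma+it)=O((|t|+1)^{C})$, uniformly for $\sigma\ge\sigma_0$ and all sufficiently large $|t|$; (iii) $\int_{-T}^{T}|\varphi(\sigma_0+it)|^2\,dt=O(T)$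 as $T\to\infty$. For $\Re s>\alpha+\beta+1$ define $\log\varphi(s)=-\sum_{n}\sum_{j}\operatorname{Log}\bigl(1-a_n^{(j)}p_n^{-f(j,n)s}\bigr)$, where $\operatorname{Log}$ is the principal branch. Let $G(\varphi)$ be the half-plane $\{\Re s\ge\sigma_0\}$ with the segments $\{x+i\,\Im\rho:\sigma_0\le x\le\Re\rho\}$ removed for all zeros and poles $\rho$ of $\varphi$ with $\Re\rho\ge\sigma_0$; for $s\in G(\varphi)$ define $\log\varphi(s)$ by analytic continuation along the horizontal half-line from the right. Let $\mu_1$ be Lebesgue measure on $\mathbb R$. **Theorem 3.1.** Let $\varphi\in\mathcal M$ and let $R\subset\mathbb C$ be a rectangle with edges parallel to the axes (a product of two bounded intervals, each open, closed or half-open). Then for every $\sigma>\sigma_0$ the limit $$W_\sigma(R;\varphi)=\lim_{T\to\infty}\frac1{2T}\,\mu_1\{t\in[-T,T]:\ \sigma+it\in G(\varphi),\ \log\varphi(\sigma+it)\in R\}$$ exists (as a finite real number). -/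

import Mathlib

open Complex Set Filter Topology MeasureTheory

noncomputable section

namespace EulerLimit

/-- The local data of a general Euler product: positive integers `g n`, and for `j` in an index
set of size `g n` positive integers `f n j` and complex numbers `a n j`. The index `n` starts at
`0`, so `n` here stands for `n + 1` in one-based counting (for the primes too, see `prm`). -/
structure EulerData where
  /-- number of linear factors attached to the `n`-th prime -/
  g : ℕ → ℕ
  /-- exponents -/
  f : (n : ℕ) → Fin (g n) → ℕ
  /-- coefficients -/
  a : (n : ℕ) → Fin (g n) → ℂ
  g_pos : ∀ n, 0 < g n
  f_pos : ∀ n j, 0 < f n j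

/-- The `n`-th prime number (`prm 0 = 2`, `prm 1 = 3`, ...). -/
def prm (n : ℕ) : ℕ := Nat.nth Nat.Prime n

namespace EulerData

variable (E : EulerData)

/-- The polynomial `A_n(X) = ∏_j (1 - a_n^{(j)} X^{f(j,n)})`. -/
def A (n : ℕ) : Polynomial ℂ :=
  ∏ j : Fin (E.g n), (1 - Polynomial.C (E.a n j) * Polynomial.X ^ (E.f n j))

/-- The Euler product `∏_n A_n(p_n^{-s})^{-1}`. -/
def eulerProduct (s : ℂ) : ℂ :=
  ∏' n : ℕ, ((E.A n).eval ((prm n : ℂ) ^ (-s)))⁻¹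

/-- The sum `-∑_n ∑_j Log (1 - a_n^{(j)} p_n^{-f(j,n)s})` with the principal branch `Log`,
which is the logarithm of the Euler product where that converges absolutely. -/
def eulerLog (s : ℂ) : ℂ :=
  -∑' n : ℕ, ∑ j : Fin (E.g n),
    Complex.log (1 - E.a n j * (prm n : ℂ) ^ (-((E.f n j : ℂ) * s)))

end EulerData

/-- The function `φ`, together with its Euler product data `E` and the parameters `α`, `β`, `σ₀`,
belongs to the class of general Euler products with polynomial growth, meromorphic continuation
to the closed half-plane `Re s ≥ σ₀` and mean square bound on the line `Re s = σ₀`.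

`MeromorphicNFOn` says that `φ` is meromorphic at every point of the half-plane and carries no
artificial values at removable singularities. -/
structure MemClassM (E : EulerData) (α β σ₀ : ℝ) (φ : ℂ → ℂ) : Prop where
  alpha_nonneg : 0 ≤ α
  beta_nonneg : 0 ≤ β
  g_le : ∃ C₁ : ℝ, 0 < C₁ ∧ ∀ n, (E.g n : ℝ) ≤ C₁ * (prm n : ℝ) ^ α
  a_le : ∀ n j, ‖E.a n j‖ ≤ (prm n : ℝ) ^ β
  le_sigma : α + β + 1 / 2 ≤ σ₀
  sigma_lt : σ₀ < α + β + 1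
  eq_eulerProduct : ∀ s : ℂ, α + β + 1 < s.re → φ s = E.eulerProduct s
  meromorphic : MeromorphicNFOn φ {s : ℂ | σ₀ ≤ s.re}
  poles : ∃ K : Set ℂ, IsCompact K ∧ K ⊆ {s : ℂ | σ₀ < s.re} ∧
    ∀ ρ : ℂ, σ₀ ≤ ρ.re → meromorphicOrderAt φ ρ < 0 → ρ ∈ K
  /-- `φ(σ + it) = O((|t| + 1)^C)` in the half-plane; as `φ` may have poles, all of them with
  bounded imaginary part, the bound is required for large `|t|`. -/
  growth : ∃ C : ℝ, 0 < C ∧ ∃ B T₀ : ℝ, ∀ σ t : ℝ, σ₀ ≤ σ → T₀ ≤ |t| →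
    ‖φ (σ + t * I)‖ ≤ B * (|t| + 1) ^ C
  meanSquare : (fun T : ℝ => ∫ t in (-T)..T, ‖φ (σ₀ + t * I)‖ ^ 2) =O[atTop] (fun T : ℝ => T)

/-- The segment `B(ρ) = {σ + i Im ρ : σ₀ ≤ σ ≤ Re ρ}`. -/
def slit (σ₀ : ℝ) (ρ : ℂ) : Set ℂ := {s : ℂ | σ₀ ≤ s.re ∧ s.re ≤ ρ.re ∧ s.im = ρ.im}

/-- The set `G(φ)`: the half-plane `Re s ≥ σ₀` with the segments `B(ρ)` removed, for all zeros
(positive order) and poles (negative order) `ρ` of `φ` with `Re ρ ≥ σ₀`. -/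
def cutDomain (σ₀ : ℝ) (φ : ℂ → ℂ) : Set ℂ :=
  {s : ℂ | σ₀ ≤ s.re} \
    ⋃ ρ ∈ {ρ : ℂ | σ₀ ≤ ρ.re ∧ (0 < meromorphicOrderAt φ ρ ∨ meromorphicOrderAt φ ρ < 0)},
      slit σ₀ ρ

/-- The horizontal half-line starting at `s` and going to the right. -/
def ray (s : ℂ) : Set ℂ := {z : ℂ | s.re ≤ z.re ∧ z.im = s.im}

/-- `w` is the value at `s` of the analytic continuation, along the horizontal half-line from
the right, of the logarithm `E.eulerLog` given in the half-plane `Re z > c`: there is a function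
`L`, analytic in a neighbourhood of every point of the half-line, which equals `E.eulerLog` on
the part of the half-line in `Re z > c`, and `w = L s`. -/
def IsLogValue (E : EulerData) (c : ℝ) (s w : ℂ) : Prop :=
  ∃ L : ℂ → ℂ, AnalyticOnNhd ℂ L (ray s) ∧
    (∀ z ∈ ray s, c < z.re → L z = E.eulerLog z) ∧ L s = w

/-- The continuation is unique. -/
theorem IsLogValue.unique {E : EulerData} {c : ℝ} {s w w' : ℂ}
    (h : IsLogValue E c s w) (h' : IsLogValue E c s w') : w = w' := by
  obtain ⟨L, hL, hLe, rfl⟩ := h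
  obtain ⟨L', hL', hLe', rfl⟩ := h'
  have hs : s ∈ ray s := ⟨le_rfl, rfl⟩
  have hconv : Convex ℝ (ray s) := by
    intro x hx y hy a b ha hb hab
    refine ⟨?_, ?_⟩
    · have h1 := mul_le_mul_of_nonneg_left hx.1 ha
      have h2 := mul_le_mul_of_nonneg_left hy.1 hb
      have h3 : s.re = a * s.re + b * s.re := by rw [← add_mul, hab, one_mul]
      simp only [add_re, real_smul, mul_re, ofReal_re, ofReal_im, zero_mul, sub_zero]
      linarith
    · have h3 : s.im = a * s.im + b * s.im := by rw [← add_mul, hab, one_mul]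
      simp only [add_im, real_smul, mul_im, ofReal_re, ofReal_im, zero_mul, add_zero, hx.2, hy.2]
      linarith
  set x₀ : ℝ := max s.re c + 1 with hx₀
  set z₀ : ℂ := ⟨x₀, s.im⟩ with hz₀
  have hx1 : s.re < x₀ := by have := le_max_left s.re c; linarith
  have hx2 : c < x₀ := by have := le_max_right s.re c; linarith
  have hz₀m : z₀ ∈ ray s := ⟨hx1.le, rfl⟩
  refine hL.eqOn_of_preconnected_of_frequently_eq hL' hconv.isPreconnected hz₀m ?_ hs
  have ht : Tendsto (fun u : ℝ => z₀ + (u : ℂ)) (𝓝[>] 0) (𝓝[≠] z₀) := by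
    refine tendsto_nhdsWithin_of_tendsto_nhds_of_eventually_within _ ?_ ?_
    · have : Continuous fun u : ℝ => z₀ + (u : ℂ) := by fun_prop
      have h0 := this.tendsto 0
      simp only [ofReal_zero, add_zero] at h0
      exact h0.mono_left nhdsWithin_le_nhds
    · filter_upwards [self_mem_nhdsWithin] with u hu
      have hu' : (0 : ℝ) < u := hu
      simpa using hu'.ne'
  refine ht.frequently (Eventually.frequently ?_)
  filter_upwards [self_mem_nhdsWithin] with u hu
  have hu' : (0 : ℝ) < u := hu
  have hm : z₀ + (u : ℂ) ∈ ray s := by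
    refine ⟨?_, ?_⟩
    · simp only [hz₀, add_re, ofReal_re]; linarith
    · simp [hz₀]
  have hc : c < (z₀ + (u : ℂ)).re := by
    simp only [hz₀, add_re, ofReal_re]; linarith
  rw [hLe _ hm hc, hLe' _ hm hc]

/-- `log φ(s)`, the analytic continuation along the horizontal path from the right; `c` is the
abscissa to the right of which the logarithm is given by `E.eulerLog`. For `s` outside
`G(φ)` the value is irrelevant. -/
def logPhi (E : EulerData) (c : ℝ) (s : ℂ) : ℂ := Classical.epsilon (IsLogValue E c s)

theorem logPhi_eq {E : EulerData} {c : ℝ} {s w : ℂ} (h : IsLogValue E c s w) :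
    logPhi E c s = w :=
  (Classical.epsilon_spec (p := IsLogValue E c s) ⟨w, h⟩).unique h

/-- `V_σ(T,R;φ)`, the Lebesgue measure of the set of `t ∈ [-T,T]` with `σ + it ∈ G(φ)` and
`log φ(σ + it) ∈ R`. -/
def V (E : EulerData) (α β σ₀ : ℝ) (φ : ℂ → ℂ) (σ T : ℝ) (R : Set ℂ) : ℝ :=
  volume.real {t : ℝ | t ∈ Icc (-T) T ∧ (σ + t * I : ℂ) ∈ cutDomain σ₀ φ ∧
    logPhi E (α + β + 1) (σ + t * I) ∈ R}

/-- A (bounded) rectangle with edges parallel to the axes: a product of two bounded intervals,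
which may be open, closed or half-open. -/
def IsRectangle (R : Set ℂ) : Prop :=
  ∃ I₁ I₂ : Set ℝ, I₁.OrdConnected ∧ I₂.OrdConnected ∧
    Bornology.IsBounded I₁ ∧ Bornology.IsBounded I₂ ∧ R = I₁ ×ℂ I₂

end EulerLimit

end

/-!
The value distribution of `log φ(σ + it)` is obtained by comparing `log φ` with the partial sums
`S_N(s) = ∑_{n < N} ∑_j -Log (1 - a_n^{(j)} p_n^{-f(j,n)s})`, which are analytic in
`Re s ≥ α + β + 1/2`, whether or not the series converges there.

*Approximation.* Fix `σ > σ₀`. For all `t` outside a set of small density, `σ + it` lies in the cut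
domain and `log φ(σ + it)` is close to `S_N(σ + it)`, for every large `N`
(`exists_forall_rare_not_close`). The function `φ exp (-S_N) - 1` is small, uniformly in `t`, in a
half-plane of absolute convergence. On a fixed large disc reaching to the left of `σ`, shifted
vertically by `t`, it is bounded for most `t`, by a bound independent of `N`: for `φ` this follows
from the mean square on `Re s = σ₀` through a Cauchy estimate on a tall rectangle, where the
polynomial growth of `φ` is beaten by a Gaussian kernel (`exists_rare_phi`); for `S_N` it follows
from the second moment of its random model (`exists_rare_partialLog`). A three circles argument
(`exists_forall_norm_le_of_three_circles`) then makes `φ exp (-S_N) - 1` small along the whole ray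
to the right of `σ + it`, so that there are no zeros on the ray and the continued logarithm is
`S_N + Log (φ exp (-S_N))` (`mem_cutDomain_and_norm_logPhi_sub_le`).

*Random model.* By unique factorization the curve `t ↦ (p_n^{-it})_{n < N}` is uniformly distributed
on a torus (`tendsto_mean_flow`), so the means over `[-T, T]` of continuous functions of
`S_N(σ + it)` converge to the expectations of the same functions of a sum of independent terms,
`EulerData.torusLog`. Each term has mean zero and the variances are summable for
`Re s > α + β + 1/2`, which bounds the second moment independently of `N`
(`exists_integral_norm_sq_torusLog_le`).

*Boundary of the rectangle.* The indicator of a rectangle is continuous except near the four lines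
that carry its sides. If some coefficient is nonzero, the corresponding local logarithm is a
nonconstant analytic function on the circle, no real linear functional of which has an atom
(`ae_re_mul_localLog_ne`). Adding independent terms cannot increase concentration, so neighbourhoods
of lines have small probability, uniformly in `N` (`exists_integral_tent_torusLog_le`). Hence the
mean in question is, for large `T`, arbitrarily close to a constant, and the limit exists by the
Cauchy criterion. If all coefficients vanish, `log φ = 0` where it is defined, and the limit is `1`
or `0`.
-/

noncomputable section

namespace EulerLimit

/-! ### Local factors and the logarithm of the Euler product -/

theorem prm_prime (n : ℕ) : (prm n).Prime := Nat.prime_nth_prime n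

theorem add_two_le_prm (n : ℕ) : n + 2 ≤ prm n := Nat.add_two_le_nth_prime n

theorem prm_pos (n : ℕ) : (0 : ℝ) < prm n := by exact_mod_cast (prm_prime n).pos

theorem one_lt_prm (n : ℕ) : (1 : ℝ) < prm n := by exact_mod_cast (prm_prime n).one_lt

theorem norm_prm_cpow (n : ℕ) (s : ℂ) : ‖(prm n : ℂ) ^ (-s)‖ = (prm n : ℝ) ^ (-s.re) := by
  rw [norm_natCast_cpow_of_pos (prm_prime n).pos, neg_re]

theorem summable_prm_rpow {e : ℝ} (he : 1 < e) : Summable fun n : ℕ => (prm n : ℝ) ^ (-e) := by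
  have h1 : Summable fun n : ℕ => ((n + 1 : ℕ) : ℝ) ^ (-e) :=
    (summable_nat_add_iff 1).2 (Real.summable_nat_rpow.2 (by linarith))
  refine h1.of_nonneg_of_le (fun n => (Real.rpow_pos_of_pos (prm_pos n) _).le) fun n => ?_
  refine Real.rpow_le_rpow_of_nonpos (by positivity) ?_ (by linarith)
  exact_mod_cast (Nat.le_succ _).trans (add_two_le_prm n)

namespace EulerData

/-- The logarithm `-∑_j Log (1 - a_n^{(j)} z ^ f(j,n))` of the inverse of the `n`-th local factor,
as a function of `z = p_n^{-s}`. -/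
def localLog (E : EulerData) (n : ℕ) (z : ℂ) : ℂ :=
  -∑ j : Fin (E.g n), Complex.log (1 - E.a n j * z ^ (E.f n j))

@[simp] theorem localLog_zero (E : EulerData) (n : ℕ) : E.localLog n 0 = 0 := by
  simp [localLog, zero_pow (E.f_pos n _).ne']

theorem localLog_cpow (E : EulerData) (n : ℕ) (s : ℂ) :
    E.localLog n ((prm n : ℂ) ^ (-s)) =
      -∑ j : Fin (E.g n), Complex.log (1 - E.a n j * (prm n : ℂ) ^ (-((E.f n j : ℂ) * s))) := by
  simp only [localLog, ← cpow_nat_mul, mul_neg]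

theorem eulerLog_eq_tsum (E : EulerData) (s : ℂ) :
    E.eulerLog s = ∑' n, E.localLog n ((prm n : ℂ) ^ (-s)) := by
  simp only [eulerLog, localLog_cpow, tsum_neg]

end EulerData

namespace MemClassM

variable {E : EulerData} {α β σ₀ : ℝ} {φ : ℂ → ℂ}

/-- On the disc `|z| ≤ p_n^{-x}`, `x ≥ β + 1/2`, every term `a_n^{(j)} z^f` is at most
`p_n^{β-x}`, which stays away from `1`. -/
theorem norm_coeff_mul_pow_le (h : MemClassM E α β σ₀ φ) {n : ℕ} {x : ℝ} (hx : β + 1 / 2 ≤ x)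
    {z : ℂ} (hz : ‖z‖ ≤ (prm n : ℝ) ^ (-x)) (j : Fin (E.g n)) :
    ‖E.a n j * z ^ (E.f n j)‖ ≤ (prm n : ℝ) ^ (β - x) := by
  have hβ := h.beta_nonneg
  have h1 : ‖z‖ ≤ 1 :=
    hz.trans (Real.rpow_le_one_of_one_le_of_nonpos (one_lt_prm n).le (by linarith))
  rw [norm_mul, norm_pow, sub_eq_add_neg, Real.rpow_add (prm_pos n)]
  gcongr
  · exact h.a_le n j
  · exact (pow_le_of_le_one (norm_nonneg _) h1 (E.f_pos n j).ne').trans hz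

theorem _root_.EulerLimit.rpow_le_three_quarters (n : ℕ) {e : ℝ} (he : e ≤ -(1 / 2)) :
    (prm n : ℝ) ^ e ≤ 3 / 4 := by
  have h2 : (2 : ℝ) ≤ prm n := by exact_mod_cast (prm_prime n).two_le
  calc (prm n : ℝ) ^ e ≤ (prm n : ℝ) ^ (-(1 / 2) : ℝ) :=
        Real.rpow_le_rpow_of_exponent_le (one_lt_prm n).le he
    _ ≤ (2 : ℝ) ^ (-(1 / 2) : ℝ) := Real.rpow_le_rpow_of_nonpos (by norm_num) h2 (by norm_num)
    _ ≤ 3 / 4 := by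
      rw [Real.rpow_neg (by norm_num), ← Real.sqrt_eq_rpow]
      have : (4 / 3 : ℝ) ≤ √2 := Real.le_sqrt_of_sq_le (by norm_num)
      calc (√2)⁻¹ ≤ (4 / 3 : ℝ)⁻¹ := by gcongr
        _ = 3 / 4 := by norm_num

theorem norm_coeff_mul_pow_le_three_quarters (h : MemClassM E α β σ₀ φ) {n : ℕ} {z : ℂ}
    (hz : ‖z‖ ≤ (prm n : ℝ) ^ (-(β + 1 / 2))) (j : Fin (E.g n)) :
    ‖E.a n j * z ^ (E.f n j)‖ ≤ 3 / 4 :=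
  (h.norm_coeff_mul_pow_le le_rfl hz j).trans (rpow_le_three_quarters n (by linarith))

theorem _root_.EulerLimit.one_sub_mem_slitPlane {w : ℂ} (hw : ‖w‖ ≤ 3 / 4) : 1 - w ∈ slitPlane := by
  refine Or.inl ?_
  have := (le_abs_self w.re).trans (abs_re_le_norm w)
  simp only [sub_re, one_re]
  linarith

theorem _root_.EulerLimit.norm_log_one_sub_le {w : ℂ} (hw : ‖w‖ ≤ 3 / 4) :
    ‖Complex.log (1 - w)‖ ≤ 4 * ‖w‖ := by
  have h0 := norm_log_one_add_le (z := -w) (by rw [norm_neg]; linarith)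
  rw [norm_neg, ← sub_eq_add_neg] at h0
  have h1 : (1 - ‖w‖)⁻¹ ≤ 4 := by
    rw [inv_le_comm₀ (by linarith) (by norm_num)]; linarith
  have h2 : ‖w‖ ^ 2 * (1 - ‖w‖)⁻¹ / 2 ≤ ‖w‖ ^ 2 * 4 / 2 := by gcongr
  nlinarith [norm_nonneg w]

/-- The basic bound: there are `O(p_n^α)` terms, each of size `O(p_n^{β-x})`. -/
theorem exists_norm_localLog_le (h : MemClassM E α β σ₀ φ) :
    ∃ C : ℝ, 0 < C ∧ ∀ (n : ℕ) (x : ℝ) (z : ℂ), β + 1 / 2 ≤ x → ‖z‖ ≤ (prm n : ℝ) ^ (-x) →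
      ‖E.localLog n z‖ ≤ C * (prm n : ℝ) ^ (α + β - x) := by
  obtain ⟨C₁, hC₁, hg⟩ := h.g_le
  refine ⟨4 * C₁, by positivity, fun n x z hx hz => ?_⟩
  have key : ∀ j : Fin (E.g n), ‖Complex.log (1 - E.a n j * z ^ (E.f n j))‖ ≤
      4 * (prm n : ℝ) ^ (β - x) := fun j => by
    have h1 := h.norm_coeff_mul_pow_le hx hz j
    have h2 : ‖E.a n j * z ^ (E.f n j)‖ ≤ 3 / 4 :=
      h1.trans (rpow_le_three_quarters n (by linarith))
    exact (norm_log_one_sub_le h2).trans (by gcongr)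
  rw [EulerData.localLog, norm_neg]
  calc _ ≤ ∑ j : Fin (E.g n), 4 * (prm n : ℝ) ^ (β - x) := norm_sum_le_of_le _ fun j _ => key j
    _ = E.g n * (4 * (prm n : ℝ) ^ (β - x)) := by simp
    _ ≤ (C₁ * (prm n : ℝ) ^ α) * (4 * (prm n : ℝ) ^ (β - x)) := by
      have := Real.rpow_nonneg (prm_pos n).le (β - x)
      gcongr
      exact hg n
    _ = 4 * C₁ * (prm n : ℝ) ^ (α + β - x) := by
      rw [show α + β - x = α + (β - x) by ring, Real.rpow_add (prm_pos n)]; ring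

theorem analyticAt_localLog (h : MemClassM E α β σ₀ φ) {n : ℕ} {z : ℂ}
    (hz : ‖z‖ ≤ (prm n : ℝ) ^ (-(β + 1 / 2))) : AnalyticAt ℂ (E.localLog n) z := by
  unfold EulerData.localLog
  refine AnalyticAt.neg (Finset.analyticAt_fun_sum _ fun j _ => AnalyticAt.clog ?_ ?_)
  · fun_prop
  · exact one_sub_mem_slitPlane (h.norm_coeff_mul_pow_le_three_quarters hz j)

theorem exp_neg_localLog (h : MemClassM E α β σ₀ φ) {n : ℕ} {z : ℂ}
    (hz : ‖z‖ ≤ (prm n : ℝ) ^ (-(β + 1 / 2))) :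
    exp (-E.localLog n z) = (E.A n).eval z := by
  rw [EulerData.localLog, neg_neg, Complex.exp_sum, EulerData.A, Polynomial.eval_prod]
  refine Finset.prod_congr rfl fun j _ => ?_
  rw [exp_log (slitPlane_ne_zero (one_sub_mem_slitPlane
    (h.norm_coeff_mul_pow_le_three_quarters hz j)))]
  simp

theorem _root_.EulerLimit.norm_prm_cpow_le {n : ℕ} {s : ℂ} {x : ℝ} (hs : x ≤ s.re) :
    ‖(prm n : ℂ) ^ (-s)‖ ≤ (prm n : ℝ) ^ (-x) := by
  rw [norm_prm_cpow]
  exact Real.rpow_le_rpow_of_exponent_le (one_lt_prm n).le (by linarith)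

theorem analyticAt_localLog_cpow (h : MemClassM E α β σ₀ φ) (n : ℕ) {s : ℂ}
    (hs : α + β + 1 / 2 ≤ s.re) :
    AnalyticAt ℂ (fun s : ℂ => E.localLog n ((prm n : ℂ) ^ (-s))) s := by
  have hα := h.alpha_nonneg
  have h1 : AnalyticAt ℂ (fun s : ℂ => (prm n : ℂ) ^ (-s)) s := by
    refine AnalyticAt.cpow analyticAt_const analyticAt_id.neg ?_
    exact Or.inl (by simpa using prm_pos n)
  exact AnalyticAt.fun_comp (h.analyticAt_localLog (norm_prm_cpow_le (by linarith))) h1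

/-- Weierstrass majorant of the logarithmic Euler product in `Re s ≥ x > α + β + 1`. -/
theorem _root_.EulerLimit.summable_majorant {α β : ℝ} (C : ℝ) {x : ℝ} (hx : α + β + 1 < x) :
    Summable fun n : ℕ => C * (prm n : ℝ) ^ (α + β - x) := by
  have := (summable_prm_rpow (e := x - α - β) (by linarith)).mul_left C
  refine this.congr fun n => ?_
  congr 2; ring

theorem summable_localLog (h : MemClassM E α β σ₀ φ) {s : ℂ} (hs : α + β + 1 < s.re) :
    Summable fun n : ℕ => E.localLog n ((prm n : ℂ) ^ (-s)) := by
  obtain ⟨C, -, hC⟩ := h.exists_norm_localLog_le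
  have hα := h.alpha_nonneg
  exact Summable.of_norm_bounded (summable_majorant C hs) fun n =>
    hC n s.re _ (by linarith) (norm_prm_cpow_le le_rfl)

theorem analyticOnNhd_eulerLog (h : MemClassM E α β σ₀ φ) :
    AnalyticOnNhd ℂ E.eulerLog {s : ℂ | α + β + 1 < s.re} := by
  intro s hs
  obtain ⟨x, hx1, hx2⟩ := exists_between (show α + β + 1 < s.re from hs)
  have hopen : IsOpen {s : ℂ | x < s.re} := isOpen_lt continuous_const continuous_re
  obtain ⟨C, -, hC⟩ := h.exists_norm_localLog_le
  have hα := h.alpha_nonneg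
  have hd : DifferentiableOn ℂ (fun s => ∑' n, E.localLog n ((prm n : ℂ) ^ (-s)))
      {s : ℂ | x < s.re} := by
    refine differentiableOn_tsum_of_summable_norm (summable_majorant C hx1) (fun n w hw => ?_)
      hopen fun n w hw => hC n x _ (by linarith) (norm_prm_cpow_le (le_of_lt hw))
    have hw' : x < w.re := hw
    exact (h.analyticAt_localLog_cpow n (by linarith)).differentiableAt.differentiableWithinAt
  have he : E.eulerLog = fun s => ∑' n, E.localLog n ((prm n : ℂ) ^ (-s)) :=
    funext E.eulerLog_eq_tsum
  rw [he]
  exact hd.analyticAt (hopen.mem_nhds hx2)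

/-- To the right of the abscissa of absolute convergence, `φ` is the exponential of `eulerLog`. -/
theorem eq_exp_eulerLog (h : MemClassM E α β σ₀ φ) {s : ℂ} (hs : α + β + 1 < s.re) :
    φ s = exp (E.eulerLog s) := by
  have hα := h.alpha_nonneg
  have hz : ∀ n, ‖(prm n : ℂ) ^ (-s)‖ ≤ (prm n : ℝ) ^ (-(β + 1 / 2)) := fun n =>
    norm_prm_cpow_le (by linarith)
  have hsum := h.summable_localLog hs
  rw [h.eq_eulerProduct s hs, EulerData.eulerProduct, E.eulerLog_eq_tsum]
  have h1 : HasProd (fun n => exp (E.localLog n ((prm n : ℂ) ^ (-s))))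
      (exp (∑' n, E.localLog n ((prm n : ℂ) ^ (-s)))) := hsum.hasSum.cexp
  rw [← h1.tprod_eq]
  refine tprod_congr fun n => ?_
  rw [← h.exp_neg_localLog (hz n), Complex.exp_neg, inv_inv]

/-- The partial sum `∑_{n < N} ∑_j -Log (1 - a_n^{(j)} p_n^{-f(j,n)s})` of the logarithm. -/
def _root_.EulerLimit.EulerData.partialLog (E : EulerData) (N : ℕ) (s : ℂ) : ℂ :=
  ∑ n ∈ Finset.range N, E.localLog n ((prm n : ℂ) ^ (-s))

theorem analyticAt_partialLog (h : MemClassM E α β σ₀ φ) (N : ℕ) {s : ℂ}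
    (hs : α + β + 1 / 2 ≤ s.re) : AnalyticAt ℂ (E.partialLog N) s := by
  unfold EulerData.partialLog
  exact Finset.analyticAt_fun_sum _ fun n _ => h.analyticAt_localLog_cpow n hs

/-- The tails of the logarithmic Euler product are small, uniformly in `Re s ≥ α + β + 2`. -/
theorem exists_forall_norm_tail_le (h : MemClassM E α β σ₀ φ) {ε : ℝ} (hε : 0 < ε) :
    ∃ N₀ : ℕ, ∀ N ≥ N₀, ∀ s : ℂ, α + β + 2 ≤ s.re → ‖E.eulerLog s - E.partialLog N s‖ ≤ ε := by
  obtain ⟨C, -, hC⟩ := h.exists_norm_localLog_le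
  have hα := h.alpha_nonneg
  have hm := summable_majorant (α := α) (β := β) C (x := α + β + 2) (by linarith)
  obtain ⟨N₀, hN₀⟩ := ((tendsto_sum_nat_add
    (fun n : ℕ => C * (prm n : ℝ) ^ (α + β - (α + β + 2))))
      |>.eventually_lt_const hε).exists_forall_of_atTop
  refine ⟨N₀, fun N hN s hs => ?_⟩
  have hsum := h.summable_localLog (s := s) (by linarith)
  rw [E.eulerLog_eq_tsum, EulerData.partialLog, ← hsum.sum_add_tsum_nat_add N, add_sub_cancel_left]
  refine (tsum_of_norm_bounded ((summable_nat_add_iff N).2 hm).hasSum fun n => ?_).trans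
    (hN₀ N hN).le
  exact hC _ _ _ (by linarith) (norm_prm_cpow_le hs)

theorem exists_norm_eulerLog_le (h : MemClassM E α β σ₀ φ) :
    ∃ B : ℝ, ∀ s : ℂ, α + β + 2 ≤ s.re → ‖E.eulerLog s‖ ≤ B := by
  obtain ⟨C, -, hC⟩ := h.exists_norm_localLog_le
  have hα := h.alpha_nonneg
  refine ⟨∑' n : ℕ, C * (prm n : ℝ) ^ (α + β - (α + β + 2)), fun s hs => ?_⟩
  rw [E.eulerLog_eq_tsum]
  exact tsum_of_norm_bounded (summable_majorant (α := α) (β := β) C (x := α + β + 2)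
    (by linarith)).hasSum fun n => hC _ _ _ (by linarith) (norm_prm_cpow_le hs)

end MemClassM

/-! ### Kronecker–Weyl equidistribution of `(p_n^{-it})_n` -/

theorem prm_injective : Function.Injective prm := Nat.nth_injective Nat.infinite_setOfPred_prime

/-- Unique factorization, in additive form: the logarithms of distinct primes are linearly
independent over the integers. -/
theorem eq_zero_of_sum_mul_log_eq_zero {ι : Type*} [Fintype ι] {p : ι → ℕ}
    (hp : ∀ i, (p i).Prime) (hinj : Function.Injective p) {k : ι → ℤ}
    (h : ∑ i, (k i : ℝ) * Real.log (p i) = 0) : k = 0 := by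
  classical
  have hpos : ∀ i, (0 : ℝ) < p i := fun i => by exact_mod_cast (hp i).pos
  have hlog : ∀ e : ι → ℕ, Real.log ((∏ i, p i ^ e i : ℕ) : ℝ) =
      ∑ i, (e i : ℝ) * Real.log (p i) := by
    intro e
    push_cast
    rw [Real.log_prod fun i _ => (pow_pos (hpos i) _).ne']
    simp
  have hpn : ∀ i, (k i : ℝ) = ((k i).toNat : ℝ) - ((-k i).toNat : ℝ) := fun i => by
    exact_mod_cast (Int.toNat_sub_toNat_neg (k i)).symm
  have h1 : Real.log ((∏ i, p i ^ (k i).toNat : ℕ) : ℝ) =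
      Real.log ((∏ i, p i ^ (-k i).toNat : ℕ) : ℝ) := by
    rw [hlog, hlog, ← sub_eq_zero, ← Finset.sum_sub_distrib, ← h]
    exact Finset.sum_congr rfl fun i _ => by rw [hpn]; ring
  have hne : ∀ e : ι → ℕ, (0 : ℝ) < ((∏ i, p i ^ e i : ℕ) : ℝ) := fun e => by
    exact_mod_cast Finset.prod_pos fun i _ => pow_pos (hp i).pos _
  have h2 : (∏ i, p i ^ (k i).toNat : ℕ) = ∏ i, p i ^ (-k i).toNat := by
    exact_mod_cast Real.log_injOn_pos (hne _) (hne _) h1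
  have hfac : ∀ (e : ι → ℕ) (j : ι), (∏ i, p i ^ e i).factorization (p j) = e j := by
    intro e j
    rw [Nat.factorization_prod fun i _ => pow_ne_zero _ (hp i).ne_zero, Finsupp.coe_finsetSum,
      Finset.sum_apply, Finset.sum_eq_single j]
    · simp [(hp j).factorization_pow]
    · intro i _ hij
      simp [(hp i).factorization_pow, hinj.ne hij]
    · simp
  funext j
  have h3 := congrArg (fun m : ℕ => m.factorization (p j)) h2
  simp only [hfac] at h3
  simp only [Pi.zero_apply]
  omega

/-- The probability Haar measure on the torus `(ℝ/ℤ)^N`. -/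
abbrev torusMeasure (N : ℕ) : Measure (UnitAddTorus (Fin N)) :=
  Measure.pi fun _ => AddCircle.haarAddCircle

/-- The linear flow on the torus for which the character of the `n`-th coordinate is
`t ↦ p_n^{-it}`. -/
def flow (N : ℕ) (t : ℝ) : UnitAddTorus (Fin N) :=
  fun n => ((-(t * Real.log (prm n)) / (2 * Real.pi) : ℝ) : UnitAddCircle)

theorem continuous_flow (N : ℕ) : Continuous (flow N) := by
  refine continuous_pi fun n => ?_
  exact (AddCircle.continuous_mk' 1).comp (by fun_prop)

theorem toCircle_flow {N : ℕ} (t : ℝ) (n : Fin N) :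
    (AddCircle.toCircle (flow N t n) : ℂ) = (prm n : ℂ) ^ (-(t * I) : ℂ) := by
  have h := fourier_coe_apply (T := (1 : ℝ)) (n := 1) (x := -(t * Real.log (prm n)) / (2 * Real.pi))
  rw [fourier_one] at h
  rw [flow, h, cpow_def_of_ne_zero (by exact_mod_cast (prm_prime n).ne_zero)]
  congr 1
  rw [show ((prm (n : ℕ) : ℂ)) = ((prm n : ℝ) : ℂ) by simp, ← ofReal_log (prm_pos n).le]
  have : (Real.pi : ℂ) ≠ 0 := by exact_mod_cast Real.pi_ne_zero
  push_cast
  field_simp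

theorem mFourier_flow {N : ℕ} (k : Fin N → ℤ) (t : ℝ) :
    UnitAddTorus.mFourier k (flow N t) =
      exp ((-(∑ n, (k n : ℝ) * Real.log (prm n)) : ℝ) * I * t) := by
  have h : ∀ n : Fin N, fourier (k n) (flow N t n) =
      exp (-((k n : ℝ) * Real.log (prm n) : ℝ) * I * t) := fun n => by
    rw [flow, fourier_coe_apply]
    congr 1
    have : (Real.pi : ℂ) ≠ 0 := by exact_mod_cast Real.pi_ne_zero
    push_cast
    field_simp
  change ∏ n, fourier (k n) (flow N t n) = _
  rw [Finset.prod_congr rfl fun n _ => h n, ← Complex.exp_sum]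
  congr 1
  push_cast
  rw [← Finset.sum_mul, ← Finset.sum_mul, Finset.sum_neg_distrib]

theorem integral_mFourier {N : ℕ} (k : Fin N → ℤ) :
    ∫ ω, UnitAddTorus.mFourier k ω ∂torusMeasure N = if k = 0 then 1 else 0 := by
  have h1 : ∀ m : ℤ, ∫ x : UnitAddCircle, fourier m x ∂AddCircle.haarAddCircle =
      if m = 0 then 1 else 0 := fun m => by
    have := congrFun (fourierCoeff_fourier (T := (1 : ℝ)) m) 0
    simp only [fourierCoeff, neg_zero, fourier_zero, one_smul] at this
    rw [this, Pi.single_apply]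
    simp [eq_comm]
  change ∫ ω, ∏ n, fourier (k n) (ω n) ∂torusMeasure N = _
  rw [integral_fintype_prod_eq_prod (fun n => fun x : UnitAddCircle => (fourier (k n) x : ℂ))]
  simp only [h1]
  split_ifs with hk
  · simp [hk]
  · obtain ⟨n, hn⟩ := Function.ne_iff.1 hk
    exact Finset.prod_eq_zero (Finset.mem_univ n) (if_neg hn)

theorem tendsto_mean_mFourier {N : ℕ} (k : Fin N → ℤ) :
    Tendsto (fun T : ℝ => (1 / (2 * T) : ℂ) * ∫ t in (-T)..T, UnitAddTorus.mFourier k (flow N t))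
      atTop (𝓝 (∫ ω, UnitAddTorus.mFourier k ω ∂torusMeasure N)) := by
  rw [integral_mFourier]
  split_ifs with hk
  · refine tendsto_const_nhds.congr' ?_
    filter_upwards [eventually_gt_atTop 0] with T hT
    have : (T : ℂ) ≠ 0 := by exact_mod_cast hT.ne'
    simp only [hk, UnitAddTorus.mFourier_zero, ContinuousMap.one_apply,
      intervalIntegral.integral_const, sub_neg_eq_add, real_smul, ofReal_add, mul_one]
    field_simp; norm_num
  · set c : ℂ := (-(∑ n, (k n : ℝ) * Real.log (prm n)) : ℝ) * I with hc
    have hc0 : c ≠ 0 := by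
      refine mul_ne_zero ?_ I_ne_zero
      rw [ofReal_ne_zero, neg_ne_zero]
      exact fun h0 => hk (eq_zero_of_sum_mul_log_eq_zero (fun n : Fin N => prm_prime n)
        (prm_injective.comp Fin.val_injective) h0)
    have hre : ∀ t : ℝ, (c * t).re = 0 := fun t => by rw [hc, mul_assoc, re_ofReal_mul]; simp
    simp only [mFourier_flow, ← hc, integral_exp_mul_complex hc0]
    rw [tendsto_zero_iff_norm_tendsto_zero]
    refine squeeze_zero' (g := fun T : ℝ => T⁻¹ * ‖c‖⁻¹) (.of_forall fun _ => norm_nonneg _) ?_ ?_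
    · filter_upwards [eventually_gt_atTop 0] with T hT
      have h2 : ‖exp (c * T) - exp (c * (-T : ℝ))‖ ≤ 2 := by
        refine (norm_sub_le _ _).trans ?_
        rw [norm_exp, norm_exp, hre, hre, Real.exp_zero]; norm_num
      rw [norm_mul, norm_div, norm_div, norm_mul, norm_one, norm_real, Real.norm_of_nonneg hT.le,
        RCLike.norm_ofNat]
      calc 1 / (2 * T) * (‖exp (c * T) - exp (c * (-T : ℝ))‖ / ‖c‖) ≤ 1 / (2 * T) * (2 / ‖c‖) := by
            gcongr
        _ = T⁻¹ * ‖c‖⁻¹ := by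
            have := norm_ne_zero_iff.2 hc0
            field_simp
    · simpa using tendsto_inv_atTop_zero.mul_const ‖c‖⁻¹

theorem norm_mean_le {h : ℝ → ℂ} {ε : ℝ} (hh : ∀ t, ‖h t‖ ≤ ε) {T : ℝ} (hT : 0 < T) :
    ‖(1 / (2 * T) : ℂ) * ∫ t in (-T)..T, h t‖ ≤ ε := by
  have h1 := intervalIntegral.norm_integral_le_of_norm_le_const (a := -T) (b := T) (C := ε)
    (f := h) fun t _ => hh t
  rw [sub_neg_eq_add, abs_of_pos (by linarith)] at h1
  rw [norm_mul, norm_div, norm_mul, norm_one, norm_real, Real.norm_of_nonneg hT.le,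
    RCLike.norm_ofNat, one_div, inv_mul_le_iff₀ (by linarith)]
  linarith

/-- **Kronecker–Weyl**: the flow `t ↦ (p_n^{-it})_n` is uniformly distributed on the torus. -/
theorem tendsto_mean_flow_complex {N : ℕ} (h : C(UnitAddTorus (Fin N), ℂ)) :
    Tendsto (fun T : ℝ => (1 / (2 * T) : ℂ) * ∫ t in (-T)..T, h (flow N t))
      atTop (𝓝 (∫ ω, h ω ∂torusMeasure N)) := by
  have hint : ∀ (g : C(UnitAddTorus (Fin N), ℂ)) (a b : ℝ),
      IntervalIntegrable (fun t => g (flow N t)) volume a b := fun g a b =>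
    (g.continuous.comp (continuous_flow N)).intervalIntegrable _ _
  have hint' : ∀ g : C(UnitAddTorus (Fin N), ℂ), Integrable g (torusMeasure N) := fun g =>
    g.continuous.integrable_of_hasCompactSupport (HasCompactSupport.of_compactSpace _)
  have hspan : ∀ g ∈ Submodule.span ℂ (range (UnitAddTorus.mFourier (d := Fin N))),
      Tendsto (fun T : ℝ => (1 / (2 * T) : ℂ) * ∫ t in (-T)..T, g (flow N t))
        atTop (𝓝 (∫ ω, g ω ∂torusMeasure N)) := by
    intro g hg
    induction hg using Submodule.span_induction with
    | mem g hg => obtain ⟨k, rfl⟩ := hg; exact tendsto_mean_mFourier k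
    | zero => simp
    | add f g _ _ hf hg =>
      simp only [ContinuousMap.add_apply]
      rw [integral_add (hint' f) (hint' g)]
      refine (hf.add hg).congr fun T => ?_
      rw [intervalIntegral.integral_add (hint f _ _) (hint g _ _), mul_add]
    | smul a g _ hg =>
      simp only [ContinuousMap.smul_apply, smul_eq_mul]
      rw [integral_const_mul]
      refine (hg.const_mul a).congr fun T => ?_
      rw [intervalIntegral.integral_const_mul]; ring
  have hmem : h ∈ closure (Submodule.span ℂ (range (UnitAddTorus.mFourier (d := Fin N))) :
      Set C(UnitAddTorus (Fin N), ℂ)) := by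
    rw [← Submodule.topologicalClosure_coe, UnitAddTorus.span_mFourier_closure_eq_top]; trivial
  rw [Metric.tendsto_atTop]
  intro ε hε
  obtain ⟨g, hg, hhg⟩ := Metric.mem_closure_iff.1 hmem (ε / 3) (by positivity)
  obtain ⟨T₀, hT₀⟩ := Metric.tendsto_atTop.1 (hspan g hg) (ε / 3) (by positivity)
  refine ⟨max T₀ 1, fun T hT => ?_⟩
  have hT1 : 0 < T := by linarith [le_max_right T₀ 1]
  have hle : ∀ ω, ‖h ω - g ω‖ ≤ ε / 3 := fun ω => by
    rw [← dist_eq_norm]; exact (ContinuousMap.dist_apply_le_dist ω).trans hhg.le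
  have e1 : ‖((1 / (2 * T) : ℂ) * ∫ t in (-T)..T, h (flow N t)) -
      (1 / (2 * T) : ℂ) * ∫ t in (-T)..T, g (flow N t)‖ ≤ ε / 3 := by
    rw [← mul_sub, ← intervalIntegral.integral_sub (hint h _ _) (hint g _ _)]
    exact norm_mean_le (fun t => hle _) hT1
  have e2 : ‖(∫ ω, g ω ∂torusMeasure N) - ∫ ω, h ω ∂torusMeasure N‖ ≤ ε / 3 := by
    rw [norm_sub_rev, ← integral_sub (hint' h) (hint' g)]
    simpa using norm_integral_le_of_norm_le_const (μ := torusMeasure N) (.of_forall hle)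
  have e3 := hT₀ T ((le_max_left _ _).trans hT)
  rw [dist_eq_norm] at e3 ⊢
  have e4 := norm_add₃_le (a := ((1 / (2 * T) : ℂ) * ∫ t in (-T)..T, h (flow N t)) -
      (1 / (2 * T) : ℂ) * ∫ t in (-T)..T, g (flow N t))
      (b := ((1 / (2 * T) : ℂ) * ∫ t in (-T)..T, g (flow N t)) - ∫ ω, g ω ∂torusMeasure N)
      (c := (∫ ω, g ω ∂torusMeasure N) - ∫ ω, h ω ∂torusMeasure N)
  rw [sub_add_sub_cancel, sub_add_sub_cancel] at e4
  linarith

/-- The real-valued form of `tendsto_mean_flow_complex`. -/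
theorem tendsto_mean_flow {N : ℕ} {h : UnitAddTorus (Fin N) → ℝ} (hc : Continuous h) :
    Tendsto (fun T : ℝ => 1 / (2 * T) * ∫ t in (-T)..T, h (flow N t))
      atTop (𝓝 (∫ ω, h ω ∂torusMeasure N)) := by
  have h1 := tendsto_mean_flow_complex ⟨fun ω => (h ω : ℂ), by fun_prop⟩
  simp only [ContinuousMap.coe_mk] at h1
  rw [integral_complex_ofReal] at h1
  refine (continuous_re.tendsto _ |>.comp h1).congr fun T => ?_
  simp only [Function.comp_apply, intervalIntegral.integral_ofReal]
  norm_cast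

/-! ### The random model and its second moment -/

theorem integral_haarAddCircle_eq_circleAverage {F : Type*} [NormedAddCommGroup F]
    [NormedSpace ℝ F] (G : ℂ → F) (z : ℂ) :
    ∫ x : UnitAddCircle, G (z * AddCircle.toCircle x) ∂AddCircle.haarAddCircle =
      Real.circleAverage (fun w => G (z * w)) 0 1 := by
  have h0 : ∀ x : ℝ, G (z * AddCircle.toCircle (x : UnitAddCircle)) =
      (fun θ : ℝ => G (z * circleMap 0 1 θ)) (2 * Real.pi * x) := fun x => by
    have h := fourier_coe_apply (T := (1 : ℝ)) (n := 1) (x := x)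
    rw [fourier_one] at h
    simp only [h, circleMap_zero, ofReal_one, one_mul]
    congr 3
    push_cast; ring
  rw [AddCircle.integral_haarAddCircle, ← UnitAddCircle.intervalIntegral_preimage 0,
    Real.circleAverage]
  simp only [h0]
  rw [intervalIntegral.integral_comp_mul_left (fun θ : ℝ => G (z * circleMap 0 1 θ))
    (by positivity)]
  simp

/-- The mean value property. -/
theorem integral_haarAddCircle_of_analytic {G : ℂ → ℂ} {z : ℂ}
    (hG : ∀ w, ‖w‖ ≤ ‖z‖ → AnalyticAt ℂ G w) :
    ∫ x : UnitAddCircle, G (z * AddCircle.toCircle x) ∂AddCircle.haarAddCircle = G 0 := by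
  rw [integral_haarAddCircle_eq_circleAverage, DiffContOnCl.circleAverage, mul_zero]
  refine DifferentiableOn.diffContOnCl fun w hw => DifferentiableAt.differentiableWithinAt ?_
  have hw' : ‖w‖ ≤ 1 := by
    have := Metric.closure_ball_subset_closedBall hw
    simpa using this
  have : AnalyticAt ℂ (fun w => G (z * w)) w := by
    refine AnalyticAt.fun_comp (hG _ ?_) (by fun_prop)
    rw [norm_mul]
    exact mul_le_of_le_one_right (norm_nonneg _) hw'
  exact this.differentiableAt

/-- Centred functions of different coordinates are orthogonal, so the second moment of their sum
is the sum of the second moments. -/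
theorem integral_sq_sum_le {N : ℕ} {Y : Fin N → UnitAddCircle → ℝ} {b : Fin N → ℝ}
    (hc : ∀ n, Continuous (Y n)) (h0 : ∀ n, ∫ x, Y n x ∂AddCircle.haarAddCircle = 0)
    (hb : ∀ n x, |Y n x| ≤ b n) :
    ∫ ω, (∑ n, Y n (ω n)) ^ 2 ∂torusMeasure N ≤ ∑ n, b n ^ 2 := by
  have hL : ∀ n, MemLp (Y n) 2 AddCircle.haarAddCircle := fun n =>
    MemLp.of_bound (hc n).aestronglyMeasurable (b n) (.of_forall (hb n))
  have hv := ProbabilityTheory.variance_sum_pi (μ := fun _ : Fin N => AddCircle.haarAddCircle) hL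
  have hmean : ∫ ω, (∑ n, fun ω : UnitAddTorus (Fin N) => Y n (ω n)) ω ∂torusMeasure N = 0 := by
    simp only [Finset.sum_apply]
    rw [integral_finsetSum]
    · refine Finset.sum_eq_zero fun n _ => ?_
      rw [← h0 n]
      exact integral_comp_eval (μ := fun _ : Fin N => AddCircle.haarAddCircle)
        (hc n).aestronglyMeasurable
    · exact fun n _ => ((hc n).comp (continuous_apply n)).integrable_of_hasCompactSupport
        (HasCompactSupport.of_compactSpace _)
  have hcs : Continuous (∑ n, fun ω : UnitAddTorus (Fin N) => Y n (ω n)) := by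
    rw [Finset.sum_fn]
    exact continuous_finsetSum _ fun n _ => (hc n).comp (continuous_apply n)
  rw [ProbabilityTheory.variance_of_integral_eq_zero hcs.aemeasurable hmean] at hv
  simp only [Finset.sum_apply] at hv
  rw [hv]
  refine Finset.sum_le_sum fun n _ => ?_
  rw [ProbabilityTheory.variance_of_integral_eq_zero (hc n).aemeasurable (h0 n)]
  calc ∫ x, Y n x ^ 2 ∂AddCircle.haarAddCircle ≤ ∫ _x, b n ^ 2 ∂AddCircle.haarAddCircle :=
        integral_mono_of_nonneg (.of_forall fun x => sq_nonneg _) (integrable_const _)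
          (.of_forall fun x => sq_le_sq' (abs_le.1 (hb n x)).1 (abs_le.1 (hb n x)).2)
    _ = b n ^ 2 := by simp

/-- The random model of `partialLog`: the numbers `p_n^{-it}` are replaced by independent
uniformly distributed points of the unit circle. -/
def EulerData.torusLog (E : EulerData) (N : ℕ) (s : ℂ) (ω : UnitAddTorus (Fin N)) : ℂ :=
  ∑ n : Fin N, E.localLog n ((prm n : ℂ) ^ (-s) * AddCircle.toCircle (ω n))

/-- Along the flow, the random model gives back the vertical shifts of `partialLog`. -/
theorem torusLog_flow (E : EulerData) (N : ℕ) (s : ℂ) (t : ℝ) :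
    E.torusLog N s (flow N t) = E.partialLog N (s + t * I) := by
  rw [EulerData.torusLog, EulerData.partialLog, Finset.sum_range]
  refine Finset.sum_congr rfl fun n _ => ?_
  rw [toCircle_flow, neg_add, cpow_add _ _ (by exact_mod_cast (prm_prime n).ne_zero)]

namespace MemClassM

variable {E : EulerData} {α β σ₀ : ℝ} {φ : ℂ → ℂ}

theorem _root_.EulerLimit.norm_prm_cpow_mul_le {n : ℕ} {s : ℂ} {x : ℝ} (hs : x ≤ s.re)
    (u : Circle) :
    ‖(prm n : ℂ) ^ (-s) * u‖ ≤ (prm n : ℝ) ^ (-x) := by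
  rw [norm_mul, Circle.norm_coe, mul_one]
  exact norm_prm_cpow_le hs

theorem continuous_localLog_circle (h : MemClassM E α β σ₀ φ) {X : Type*} [TopologicalSpace X]
    (n : ℕ) {s : X → ℂ} (hs : Continuous s) (hre : ∀ x, α + β + 1 / 2 ≤ (s x).re)
    {θ : X → UnitAddCircle} (hθ : Continuous θ) :
    Continuous fun x => E.localLog n ((prm n : ℂ) ^ (-(s x)) * AddCircle.toCircle (θ x)) := by
  have hα := h.alpha_nonneg
  have hz : Continuous fun x => (prm n : ℂ) ^ (-(s x)) * AddCircle.toCircle (θ x) := by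
    refine Continuous.mul ?_ (continuous_subtype_val.comp (AddCircle.continuous_toCircle.comp hθ))
    exact continuous_const.cpow hs.neg fun x => Or.inl (by simpa using prm_pos n)
  refine continuous_iff_continuousAt.2 fun x => ?_
  have hx : ContinuousAt (E.localLog n) ((prm n : ℂ) ^ (-(s x)) * AddCircle.toCircle (θ x)) :=
    (h.analyticAt_localLog (norm_prm_cpow_mul_le (by linarith [hre x]) _)).continuousAt
  exact ContinuousAt.comp' hx hz.continuousAt

theorem continuous_torusLog (h : MemClassM E α β σ₀ φ) {X : Type*} [TopologicalSpace X]
    (N : ℕ) {s : X → ℂ} (hs : Continuous s) (hre : ∀ x, α + β + 1 / 2 ≤ (s x).re)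
    {θ : X → UnitAddTorus (Fin N)} (hθ : Continuous θ) :
    Continuous fun x => E.torusLog N (s x) (θ x) := by
  unfold EulerData.torusLog
  exact continuous_finsetSum _ fun n _ =>
    h.continuous_localLog_circle n hs hre ((continuous_apply n).comp hθ)

theorem integral_localLog_circle (h : MemClassM E α β σ₀ φ) (n : ℕ) {s : ℂ}
    (hs : α + β + 1 / 2 ≤ s.re) :
    ∫ x : UnitAddCircle, E.localLog n ((prm n : ℂ) ^ (-s) * AddCircle.toCircle x)
      ∂AddCircle.haarAddCircle = 0 := by
  have hα := h.alpha_nonneg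
  rw [integral_haarAddCircle_of_analytic, E.localLog_zero]
  exact fun w hw => h.analyticAt_localLog (hw.trans (norm_prm_cpow_le (by linarith)))

/-- The second moment of the random model is bounded independently of the number of primes: this
is where `Re s > α + β + 1/2` is used. -/
theorem exists_integral_norm_sq_torusLog_le (h : MemClassM E α β σ₀ φ) {x : ℝ}
    (hx : α + β + 1 / 2 < x) :
    ∃ B : ℝ, 0 ≤ B ∧ ∀ (N : ℕ) (s : ℂ), x ≤ s.re →
      ∫ ω, ‖E.torusLog N s ω‖ ^ 2 ∂torusMeasure N ≤ B := by
  obtain ⟨C, hC0, hC⟩ := h.exists_norm_localLog_le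
  have hα := h.alpha_nonneg
  have hsum : Summable fun n : ℕ => (C * (prm n : ℝ) ^ (α + β - x)) ^ 2 := by
    refine ((summable_prm_rpow (e := 2 * (x - α - β)) (by linarith)).mul_left (C ^ 2)).congr
      fun n => ?_
    rw [mul_pow, ← Real.rpow_natCast, ← Real.rpow_natCast, ← Real.rpow_mul (prm_pos n).le]
    congr 2
    push_cast; ring
  refine ⟨2 * ∑' n : ℕ, (C * (prm n : ℝ) ^ (α + β - x)) ^ 2, by positivity, fun N s hs => ?_⟩
  set X : Fin N → UnitAddCircle → ℂ := fun n y =>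
    E.localLog n ((prm n : ℂ) ^ (-s) * AddCircle.toCircle y) with hX
  have hXc : ∀ n, Continuous (X n) := fun n =>
    h.continuous_localLog_circle n continuous_const (fun _ => by linarith) continuous_id
  have hXi : ∀ n, Integrable (X n) AddCircle.haarAddCircle := fun n =>
    (hXc n).integrable_of_hasCompactSupport (HasCompactSupport.of_compactSpace _)
  have hX0 : ∀ n, ∫ y, X n y ∂AddCircle.haarAddCircle = 0 := fun n =>
    h.integral_localLog_circle n (by linarith)
  have hXb : ∀ n y, ‖X n y‖ ≤ C * (prm n : ℝ) ^ (α + β - x) := fun n y =>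
    hC n x _ (by linarith) (norm_prm_cpow_mul_le hs _)
  have hre := integral_sq_sum_le (Y := fun n y => (X n y).re) (fun n => continuous_re.comp (hXc n))
    (fun n => by
      have := reCLM.integral_comp_comm (hXi n)
      simpa [hX0 n] using this) fun n y => (abs_re_le_norm _).trans (hXb n y)
  have him := integral_sq_sum_le (Y := fun n y => (X n y).im) (fun n => continuous_im.comp (hXc n))
    (fun n => by
      have := imCLM.integral_comp_comm (hXi n)
      simpa [hX0 n] using this) fun n y => (abs_im_le_norm _).trans (hXb n y)
  have hle : ∑ n : Fin N, (C * (prm n : ℝ) ^ (α + β - x)) ^ 2 ≤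
      ∑' n : ℕ, (C * (prm n : ℝ) ^ (α + β - x)) ^ 2 := by
    rw [← Finset.sum_range (fun n : ℕ => (C * (prm n : ℝ) ^ (α + β - x)) ^ 2)]
    exact hsum.sum_le_tsum _ fun n _ => sq_nonneg _
  have hsq : ∀ ω : UnitAddTorus (Fin N), ‖E.torusLog N s ω‖ ^ 2 =
      (∑ n, (X n (ω n)).re) ^ 2 + (∑ n, (X n (ω n)).im) ^ 2 := fun ω => by
    rw [← normSq_eq_norm_sq, normSq_apply, EulerData.torusLog, re_sum, im_sum, sq, sq]
  simp only [hsq]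
  have hci : ∀ f : UnitAddTorus (Fin N) → ℝ, Continuous f → Integrable f (torusMeasure N) :=
    fun f hf => hf.integrable_of_hasCompactSupport (HasCompactSupport.of_compactSpace _)
  rw [integral_add (hci _ (by fun_prop)) (hci _ (by fun_prop))]
  linarith

end MemClassM

/-! ### Complex analysis: three circles and a Cauchy estimate on tall rectangles -/

/-- A qualitative three circles theorem: an analytic function that is bounded on a disc and small
on a concentric smaller disc is small on every disc in between, since its Taylor coefficients
satisfy both Cauchy estimates. -/
theorem exists_forall_norm_le_of_three_circles {r₁ r₂ r₃ : ℝ} (h₁ : 0 < r₁) (h₂ : r₁ < r₂)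
    (h₃ : r₂ < r₃) (M : ℝ) {η : ℝ} (hη : 0 < η) :
    ∃ δ : ℝ, 0 < δ ∧ ∀ (F : ℂ → ℂ) (c : ℂ), (∀ z ∈ Metric.closedBall c r₃, AnalyticAt ℂ F z) →
      (∀ z ∈ Metric.closedBall c r₃, ‖F z‖ ≤ M) → (∀ z ∈ Metric.closedBall c r₁, ‖F z‖ ≤ δ) →
      ∀ z ∈ Metric.closedBall c r₂, ‖F z‖ ≤ η := by
  have hr2 : 0 < r₂ := h₁.trans h₂
  have hr3 : 0 < r₃ := hr2.trans h₃
  set q := r₂ / r₃ with hq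
  have hq0 : 0 ≤ q := by positivity
  have hq1 : q < 1 := (div_lt_one hr3).2 h₃
  have hs : Summable fun n : ℕ => |M| * q ^ n := (summable_geometric_of_lt_one hq0 hq1).mul_left _
  obtain ⟨K, hK⟩ := ((tendsto_sum_nat_add fun n : ℕ => |M| * q ^ n).eventually_lt_const
    (half_pos hη)).exists
  set S := ∑ n ∈ Finset.range K, (r₂ / r₁) ^ n with hS
  have hS0 : 0 ≤ S := by positivity
  refine ⟨η / 2 / (S + 1), by positivity, fun F c hF hM hδ z hz => ?_⟩
  have hzn : ‖z - c‖ ≤ r₂ := by simpa [dist_eq_norm] using hz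
  have hball : DifferentiableOn ℂ F (Metric.ball c r₃) := fun w hw =>
    (hF w (Metric.ball_subset_closedBall hw)).differentiableAt.differentiableWithinAt
  have hsum := hasSum_taylorSeries_on_ball hball (z := z) (by
    rw [mem_ball_iff_norm]; exact hzn.trans_lt h₃)
  set a : ℕ → ℂ := fun n => (n.factorial : ℂ)⁻¹ • (z - c) ^ n • iteratedDeriv n F c with ha
  have hcoeff : ∀ r B : ℝ, 0 < r → r ≤ r₃ → (∀ w ∈ Metric.closedBall c r, ‖F w‖ ≤ B) → ∀ n,
      ‖a n‖ ≤ B * (r₂ / r) ^ n := by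
    intro r B hr hr' hB n
    have hd : DiffContOnCl ℂ F (Metric.ball c r) := by
      refine DifferentiableOn.diffContOnCl fun w hw => ?_
      have hw' := Metric.closure_ball_subset_closedBall hw
      have hFw := hF w (Metric.closedBall_subset_closedBall hr' hw')
      exact hFw.differentiableAt.differentiableWithinAt
    have hB0 : 0 ≤ B := (norm_nonneg _).trans (hB c (Metric.mem_closedBall_self hr.le))
    have h := norm_iteratedDeriv_le_of_forall_mem_sphere_norm_le n hr hd
      fun w hw => hB w (Metric.sphere_subset_closedBall hw)
    have hfac : (0 : ℝ) < n.factorial := by exact_mod_cast n.factorial_pos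
    rw [ha]
    simp only [norm_smul, norm_inv, norm_pow, norm_natCast]
    calc (n.factorial : ℝ)⁻¹ * (‖z - c‖ ^ n * ‖iteratedDeriv n F c‖)
        ≤ (n.factorial : ℝ)⁻¹ * (r₂ ^ n * (n.factorial * B / r ^ n)) := by gcongr
      _ = B * (r₂ / r) ^ n := by
        rw [div_pow]; field_simp
  have hM' := hcoeff r₃ |M| hr3 le_rfl fun w hw => (hM w hw).trans (le_abs_self M)
  have hδ' := hcoeff r₁ _ h₁ (h₂.trans h₃).le hδ
  have hsa : Summable a := hsum.summable
  rw [← hsum.tsum_eq, ← hsa.sum_add_tsum_nat_add K]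
  have e1 : ‖∑ n ∈ Finset.range K, a n‖ ≤ η / 2 := by
    refine (norm_sum_le_of_le _ fun n _ => hδ' n).trans ?_
    rw [← Finset.mul_sum, ← hS, div_mul_eq_mul_div, div_le_iff₀ (by positivity)]
    nlinarith
  have e2 : ‖∑' n, a (n + K)‖ ≤ η / 2 :=
    (tsum_of_norm_bounded ((summable_nat_add_iff K).2 hs).hasSum fun n => hM' (n + K)).trans hK.le
  exact (norm_add_le _ _).trans (by linarith)

/-- The values in a disc are controlled by the mean over a larger circle. -/
theorem norm_le_circle_mean {r R : ℝ} (hr : 0 ≤ r) (hrR : r < R) {F : ℂ → ℂ} {c w : ℂ}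
    (hF : ∀ z ∈ Metric.closedBall c R, AnalyticAt ℂ F z) (hw : w ∈ Metric.closedBall c r) :
    ‖F w‖ ≤ R / (R - r) * ∫ θ in (0)..(2 * Real.pi), ‖F (circleMap c R θ)‖ := by
  have hR : 0 < R := hr.trans_lt hrR
  have hwr : ‖w - c‖ ≤ r := by simpa [dist_eq_norm] using hw
  have hd : DiffContOnCl ℂ F (Metric.ball c |R|) := by
    rw [abs_of_pos hR]
    refine DifferentiableOn.diffContOnCl fun z hz => ?_
    exact (hF z (Metric.closure_ball_subset_closedBall hz)).differentiableAt.differentiableWithinAt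
  have hmem : ∀ θ, circleMap c R θ ∈ Metric.closedBall c R := fun θ =>
    circleMap_mem_closedBall c hR.le θ
  have hcont : Continuous fun θ => ‖F (circleMap c R θ)‖ := by
    refine Continuous.norm (continuous_iff_continuousAt.2 fun θ => ?_)
    exact ContinuousAt.comp' (hF _ (hmem θ)).continuousAt (continuous_circleMap c R).continuousAt
  rw [← hd.circleAverage_smul_div (w := w) (by
    rw [abs_of_pos hR, mem_ball_iff_norm]; exact hwr.trans_lt hrR), Real.circleAverage, norm_smul]
  have h1 : ‖∫ θ in (0)..(2 * Real.pi), ((circleMap c R θ - c) / (circleMap c R θ - w)) •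
      F (circleMap c R θ)‖ ≤ ∫ θ in (0)..(2 * Real.pi), R / (R - r) * ‖F (circleMap c R θ)‖ := by
    refine intervalIntegral.norm_integral_le_of_norm_le (by positivity) (.of_forall fun θ _ => ?_)
      ((hcont.const_mul _).intervalIntegrable _ _)
    rw [norm_smul, norm_div]
    have e1 : ‖circleMap c R θ - c‖ = R := by simp [circleMap, abs_of_pos hR]
    have e2 : R - r ≤ ‖circleMap c R θ - w‖ := by
      have := norm_sub_norm_le (circleMap c R θ - c) (w - c)
      rw [sub_sub_sub_cancel_right, e1] at this
      linarith
    rw [e1]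
    have : 0 < R - r := by linarith
    gcongr
  rw [intervalIntegral.integral_const_mul] at h1
  have h2 : ‖(2 * Real.pi)⁻¹‖ ≤ 1 := by
    rw [Real.norm_of_nonneg (by positivity)]
    exact inv_le_one_of_one_le₀ (by linarith [Real.two_le_pi])
  exact (mul_le_of_le_one_left (norm_nonneg _) h2).trans h1

theorem integral_gaussian_translate_le (y a b : ℝ) (hab : a ≤ b) :
    ∫ v in a..b, Real.exp (-(v - y) ^ 2) ≤ √Real.pi := by
  have hg : Integrable fun v : ℝ => Real.exp (-(v - y) ^ 2) := by
    simpa using (integrable_exp_neg_mul_sq (b := 1) one_pos).comp_sub_right y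
  rw [intervalIntegral.integral_of_le hab]
  refine (setIntegral_le_integral hg (.of_forall fun v => (Real.exp_pos _).le)).trans_eq ?_
  rw [integral_sub_right_eq_self (fun v : ℝ => Real.exp (-v ^ 2)) y]
  simpa using integral_gaussian 1

/-- The contour integral of `1 / (z - s)` over the boundary of a rectangle around `s` does not
vanish: each of the four sides contributes a nonnegative imaginary part. -/
theorem le_im_rectangle_inv {x₀ x₁ x₂ x₃ x H : ℝ} (h01 : x₀ < x₁) (h23 : x₂ < x₃) (hx1 : x₁ ≤ x)
    (hx2 : x ≤ x₂) (hH : 1 ≤ H) (y : ℝ) :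
    2 * ((x₃ - x₂) / ((x₃ - x₀) ^ 2 + 1)) ≤
      ((∫ u : ℝ in x₀..x₃, ((u + (y - H : ℝ) * I) - (x + y * I) : ℂ)⁻¹) -
        (∫ u : ℝ in x₀..x₃, ((u + (y + H : ℝ) * I) - (x + y * I) : ℂ)⁻¹) +
        I • (∫ v : ℝ in (y - H)..(y + H), ((x₃ + v * I) - (x + y * I) : ℂ)⁻¹) -
        I • (∫ v : ℝ in (y - H)..(y + H), ((x₀ + v * I) - (x + y * I) : ℂ)⁻¹)).im := by
  have hx0 : x₀ ≤ x₃ := by linarith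
  have hH0 : y - H ≤ y + H := by linarith
  have ib : IntervalIntegrable (fun u : ℝ => ((u + (y - H : ℝ) * I) - (x + y * I) : ℂ)⁻¹)
      volume x₀ x₃ := by
    refine (Continuous.inv₀ (by fun_prop) fun u h => ?_).intervalIntegrable _ _
    have := congrArg im h
    simp at this; linarith
  have it : IntervalIntegrable (fun u : ℝ => ((u + (y + H : ℝ) * I) - (x + y * I) : ℂ)⁻¹)
      volume x₀ x₃ := by
    refine (Continuous.inv₀ (by fun_prop) fun u h => ?_).intervalIntegrable _ _
    have := congrArg im h
    simp at this; linarith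
  have ir : IntervalIntegrable (fun v : ℝ => ((x₃ + v * I) - (x + y * I) : ℂ)⁻¹)
      volume (y - H) (y + H) := by
    refine (Continuous.inv₀ (by fun_prop) fun u h => ?_).intervalIntegrable _ _
    have := congrArg re h
    simp at this; linarith
  have il : IntervalIntegrable (fun v : ℝ => ((x₀ + v * I) - (x + y * I) : ℂ)⁻¹)
      volume (y - H) (y + H) := by
    refine (Continuous.inv₀ (by fun_prop) fun u h => ?_).intervalIntegrable _ _
    have := congrArg re h
    simp at this; linarith
  have im_eq : ∀ {f : ℝ → ℂ} {a b : ℝ}, IntervalIntegrable f volume a b →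
      (∫ u in a..b, f u).im = ∫ u in a..b, (f u).im := fun hf =>
    (imCLM.intervalIntegral_comp_comm hf).symm
  have re_eq : ∀ {f : ℝ → ℂ} {a b : ℝ}, IntervalIntegrable f volume a b →
      (∫ u in a..b, f u).re = ∫ u in a..b, (f u).re := fun hf =>
    (reCLM.intervalIntegral_comp_comm hf).symm
  simp only [sub_im, add_im, smul_eq_mul, mul_im, I_re, I_im, zero_mul, one_mul, zero_add]
  rw [im_eq ib, im_eq it, re_eq ir, re_eq il]
  have e1 : 0 ≤ ∫ u in x₀..x₃, (((u + (y - H : ℝ) * I) - (x + y * I) : ℂ)⁻¹).im := by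
    refine intervalIntegral.integral_nonneg hx0 fun u _ => ?_
    rw [inv_im]
    refine div_nonneg ?_ (normSq_nonneg _)
    simp; linarith
  have e2 : ∫ u in x₀..x₃, (((u + (y + H : ℝ) * I) - (x + y * I) : ℂ)⁻¹).im ≤ 0 := by
    rw [← neg_nonneg, ← intervalIntegral.integral_neg]
    refine intervalIntegral.integral_nonneg hx0 fun u _ => ?_
    rw [inv_im, neg_nonneg]
    refine div_nonpos_of_nonpos_of_nonneg ?_ (normSq_nonneg _)
    simp; linarith
  have e4 : ∫ v in (y - H)..(y + H), (((x₀ + v * I) - (x + y * I) : ℂ)⁻¹).re ≤ 0 := by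
    rw [← neg_nonneg, ← intervalIntegral.integral_neg]
    refine intervalIntegral.integral_nonneg hH0 fun u _ => ?_
    rw [inv_re, neg_nonneg]
    refine div_nonpos_of_nonpos_of_nonneg ?_ (normSq_nonneg _)
    simp; linarith
  have hre : ∀ v : ℝ, (((x₃ + v * I) - (x + y * I) : ℂ)⁻¹).re =
      (x₃ - x) / ((x₃ - x) ^ 2 + (v - y) ^ 2) := fun v => by
    rw [inv_re, normSq_apply]
    simp [sq]
  have e3 : 2 * ((x₃ - x₂) / ((x₃ - x₀) ^ 2 + 1)) ≤
      ∫ v in (y - H)..(y + H), (((x₃ + v * I) - (x + y * I) : ℂ)⁻¹).re := by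
    have ir' : IntervalIntegrable (fun v : ℝ => (((x₃ + v * I) - (x + y * I) : ℂ)⁻¹).re)
      volume (y - H) (y + H) := ⟨ir.1.re, ir.2.re⟩
    calc 2 * ((x₃ - x₂) / ((x₃ - x₀) ^ 2 + 1))
        = ∫ _v in (y - 1)..(y + 1), (x₃ - x₂) / ((x₃ - x₀) ^ 2 + 1) := by
          rw [intervalIntegral.integral_const, smul_eq_mul]; ring
      _ ≤ ∫ v in (y - 1)..(y + 1), (((x₃ + v * I) - (x + y * I) : ℂ)⁻¹).re := by
          refine intervalIntegral.integral_mono_on (by linarith) (by simp)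
            (ir'.mono_set ?_) fun v hv => ?_
          · rw [uIcc_of_le (by linarith), uIcc_of_le hH0]
            exact Icc_subset_Icc (by linarith) (by linarith)
          · rw [hre]
            have hv2 : (v - y) ^ 2 ≤ 1 := by
              rw [sq_le_one_iff_abs_le_one, abs_le]; constructor <;> linarith [hv.1, hv.2]
            have hpos : 0 < (x₃ - x) ^ 2 := pow_pos (by linarith) 2
            gcongr <;> linarith
      _ ≤ _ := by
          refine intervalIntegral.integral_mono_interval (by linarith) (by linarith)
            (by linarith) (.of_forall fun v => ?_) ir'
          simp only [Pi.zero_apply]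
          rw [hre]
          exact div_nonneg (by linarith) (by positivity)
  linarith

/-- A Cauchy estimate on a rectangle with the kernel `exp ((z - s)²) / (z - s)`: the values inside
are controlled by a Gaussian mean over the left side, a bound `B` on the right side, and a bound `A`
on the horizontal sides at distance `H`, damped by `exp (-H²)`. -/
theorem exists_norm_le_rectangle {x₀ x₁ x₂ x₃ : ℝ} (h01 : x₀ < x₁) (h12 : x₁ ≤ x₂)
    (h23 : x₂ < x₃) :
    ∃ K : ℝ, 0 < K ∧ ∀ (F : ℂ → ℂ) (x y H A B : ℝ), x₁ ≤ x → x ≤ x₂ → 1 ≤ H → 0 ≤ A → 0 ≤ B →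
      (∀ z ∈ Icc x₀ x₃ ×ℂ Icc (y - H) (y + H), AnalyticAt ℂ F z) →
      (∀ v ∈ Icc (y - H) (y + H), ‖F (x₃ + v * I)‖ ≤ B) →
      (∀ u ∈ Icc x₀ x₃, ‖F (u + (y - H : ℝ) * I)‖ ≤ A ∧ ‖F (u + (y + H : ℝ) * I)‖ ≤ A) →
      ‖F (x + y * I)‖ ≤ K * ((∫ v in (y - H)..(y + H), ‖F (x₀ + v * I)‖ * Real.exp (-(v - y) ^ 2)) +
        B + A * Real.exp (-H ^ 2)) := by
  set d := x₃ - x₀ with hd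
  set κ := 2 * ((x₃ - x₂) / (d ^ 2 + 1)) with hκ
  have hκ0 : 0 < κ := by
    have : 0 < x₃ - x₂ := by linarith
    positivity
  have hd0 : 0 < d := by linarith
  set M := Real.exp (d ^ 2) with hM
  have p1 : 0 < x₁ - x₀ := by linarith
  have p2 : 0 < x₃ - x₂ := by linarith
  refine ⟨κ⁻¹ * (M / (x₁ - x₀) + M * √Real.pi / (x₃ - x₂) + 2 * d * M), by positivity,
    fun F x y H A B hx1 hx2 hH hA hB hF hr hbt => ?_⟩
  set s : ℂ := x + y * I with hs
  have hsre : s.re = x := by simp [hs]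
  have hsim : s.im = y := by simp [hs]
  set G : ℂ → ℂ := fun z => F z * exp ((z - s) ^ 2) with hG
  have hGs : G s = F s := by simp [hG]
  have hGa : ∀ z ∈ Icc x₀ x₃ ×ℂ Icc (y - H) (y + H), AnalyticAt ℂ G z := fun z hz =>
    (hF z hz).mul (by fun_prop)
  have hx0 : x₀ ≤ x₃ := by linarith
  have hH0 : y - H ≤ y + H := by linarith
  have hsn : Icc x₀ x₃ ×ℂ Icc (y - H) (y + H) ∈ 𝓝 s := by
    rw [mem_nhds_iff]
    refine ⟨Ioo x₀ x₃ ×ℂ Ioo (y - H) (y + H), ?_, isOpen_Ioo.reProdIm isOpen_Ioo, ?_⟩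
    · exact fun z hz => ⟨Ioo_subset_Icc_self hz.1, Ioo_subset_Icc_self hz.2⟩
    · rw [mem_reProdIm, hsre, hsim]
      exact ⟨⟨by linarith, by linarith⟩, by linarith, by linarith⟩
  have hdiff : DifferentiableOn ℂ (dslope G s) (Icc x₀ x₃ ×ℂ Icc (y - H) (y + H)) :=
    (differentiableOn_dslope hsn).2 fun z hz => (hGa z hz).differentiableAt.differentiableWithinAt
  have hcauchy := integral_boundary_rect_eq_zero_of_differentiableOn (dslope G s)
    ⟨x₀, y - H⟩ ⟨x₃, y + H⟩ (by simpa only [uIcc_of_le hx0, uIcc_of_le hH0] using hdiff)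
  simp only at hcauchy
  -- on a side of the rectangle, the divided difference splits into the two Cauchy kernels
  have side : ∀ (γ : ℝ → ℂ) (a b : ℝ), a ≤ b → Continuous γ → (∀ u, γ u ≠ s) →
      (∀ u ∈ Icc a b, γ u ∈ Icc x₀ x₃ ×ℂ Icc (y - H) (y + H)) →
      ∫ u in a..b, dslope G s (γ u) =
        (∫ u in a..b, (γ u - s)⁻¹ * G (γ u)) - F s * ∫ u in a..b, (γ u - s)⁻¹ := by
    intro γ a b hab hγ hne hmem
    have hinv : Continuous fun u => (γ u - s)⁻¹ :=
      (hγ.sub continuous_const).inv₀ fun u => sub_ne_zero.2 (hne u)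
    have hGc : ContinuousOn (fun u => G (γ u)) (uIcc a b) := by
      rw [uIcc_of_le hab]
      exact fun u hu => ((hGa _ (hmem u hu)).continuousAt.comp' hγ.continuousAt).continuousWithinAt
    have hi : IntervalIntegrable (fun u => (γ u - s)⁻¹ * G (γ u)) volume a b :=
      (hinv.continuousOn.mul hGc).intervalIntegrable
    rw [← intervalIntegral.integral_const_mul, ← intervalIntegral.integral_sub hi
      ((hinv.const_mul _).intervalIntegrable _ _)]
    refine intervalIntegral.integral_congr fun u _ => ?_
    rw [dslope_of_ne _ (hne u), slope_def_module, hGs, smul_eq_mul]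
    ring
  have nb : ∀ u : ℝ, (u + (y - H : ℝ) * I : ℂ) ≠ s := fun u h => by
    have := congrArg im h
    rw [hsim] at this; simp at this; linarith
  have nt : ∀ u : ℝ, (u + (y + H : ℝ) * I : ℂ) ≠ s := fun u h => by
    have := congrArg im h
    rw [hsim] at this; simp at this; linarith
  have nr : ∀ v : ℝ, (x₃ + v * I : ℂ) ≠ s := fun u h => by
    have := congrArg re h
    rw [hsre] at this; simp at this; linarith
  have nl : ∀ v : ℝ, (x₀ + v * I : ℂ) ≠ s := fun u h => by
    have := congrArg re h
    rw [hsre] at this; simp at this; linarith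
  have mb : ∀ u ∈ Icc x₀ x₃, (u + (y - H : ℝ) * I : ℂ) ∈ Icc x₀ x₃ ×ℂ Icc (y - H) (y + H) :=
    fun u hu => ⟨by simpa using hu, by simp; linarith⟩
  have mt : ∀ u ∈ Icc x₀ x₃, (u + (y + H : ℝ) * I : ℂ) ∈ Icc x₀ x₃ ×ℂ Icc (y - H) (y + H) :=
    fun u hu => ⟨by simpa using hu, by simp; linarith⟩
  have mr : ∀ v ∈ Icc (y - H) (y + H), (x₃ + v * I : ℂ) ∈ Icc x₀ x₃ ×ℂ Icc (y - H) (y + H) :=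
    fun v hv => ⟨by simpa using hx0, by simpa using hv⟩
  have ml : ∀ v ∈ Icc (y - H) (y + H), (x₀ + v * I : ℂ) ∈ Icc x₀ x₃ ×ℂ Icc (y - H) (y + H) :=
    fun v hv => ⟨by simpa using hx0, by simpa using hv⟩
  rw [side _ _ _ hx0 (by fun_prop) nb mb, side _ _ _ hx0 (by fun_prop) nt mt,
    side _ _ _ hH0 (by fun_prop) nr mr, side _ _ _ hH0 (by fun_prop) nl ml] at hcauchy
  have hJ := le_im_rectangle_inv h01 h23 hx1 hx2 hH y
  rw [← hs, ← hd, ← hκ] at hJ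
  set Jb := ∫ u : ℝ in x₀..x₃, ((u + (y - H : ℝ) * I : ℂ) - s)⁻¹
  set Jt := ∫ u : ℝ in x₀..x₃, ((u + (y + H : ℝ) * I : ℂ) - s)⁻¹
  set Jr := ∫ v : ℝ in (y - H)..(y + H), ((x₃ + v * I : ℂ) - s)⁻¹
  set Jl := ∫ v : ℝ in (y - H)..(y + H), ((x₀ + v * I : ℂ) - s)⁻¹
  set Kb := ∫ u : ℝ in x₀..x₃, ((u + (y - H : ℝ) * I : ℂ) - s)⁻¹ * G (u + (y - H : ℝ) * I) with hKb
  set Kt := ∫ u : ℝ in x₀..x₃, ((u + (y + H : ℝ) * I : ℂ) - s)⁻¹ * G (u + (y + H : ℝ) * I) with hKt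
  set Kr := ∫ v : ℝ in (y - H)..(y + H), ((x₃ + v * I : ℂ) - s)⁻¹ * G (x₃ + v * I) with hKr
  set Kl := ∫ v : ℝ in (y - H)..(y + H), ((x₀ + v * I : ℂ) - s)⁻¹ * G (x₀ + v * I) with hKl
  have heq : F s * (Jb - Jt + I • Jr - I • Jl) = Kb - Kt + I • Kr - I • Kl := by
    simp only [smul_eq_mul] at hcauchy ⊢
    linear_combination -hcauchy
  have hle : ‖F s‖ * κ ≤ ‖Kb‖ + ‖Kt‖ + ‖Kr‖ + ‖Kl‖ := by
    calc ‖F s‖ * κ ≤ ‖F s‖ * ‖Jb - Jt + I • Jr - I • Jl‖ := by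
          gcongr
          exact hJ.trans ((le_abs_self _).trans (abs_im_le_norm _))
      _ = ‖Kb - Kt + I • Kr - I • Kl‖ := by rw [← norm_mul, heq]
      _ ≤ ‖Kb‖ + ‖Kt‖ + ‖I • Kr‖ + ‖I • Kl‖ := by
          refine (norm_sub_le _ _).trans ?_
          gcongr
          refine (norm_add_le _ _).trans ?_
          gcongr
          exact norm_sub_le _ _
      _ = _ := by simp
  have hexp : ∀ z : ℂ, ‖exp ((z - s) ^ 2)‖ = Real.exp ((z.re - x) ^ 2 - (z.im - y) ^ 2) := by
    intro z
    rw [norm_exp, sq, mul_re, sub_re, sub_im, hsre, hsim, sq, sq]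
  have hkern : ∀ (z : ℂ) (W : ℝ), |z.re - x| ≤ d → ‖F z‖ ≤ W →
      ‖G z‖ ≤ W * M * Real.exp (-(z.im - y) ^ 2) := by
    intro z W hz hW
    have hW0 := (norm_nonneg _).trans hW
    have : (z.re - x) ^ 2 ≤ d ^ 2 := by rw [← sq_abs]; gcongr
    rw [hG, norm_mul, hexp, mul_assoc, hM, ← Real.exp_add]
    gcongr
    linarith
  have hhor : ∀ w : ℝ, |w - y| = H → (∀ u ∈ Icc x₀ x₃, ‖F (u + w * I)‖ ≤ A) →
      ‖∫ u : ℝ in x₀..x₃, ((u + w * I : ℂ) - s)⁻¹ * G (u + w * I)‖ ≤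
        A * M * Real.exp (-H ^ 2) * d := by
    intro w hw hFA
    have h := intervalIntegral.norm_integral_le_of_norm_le_const (a := x₀) (b := x₃)
      (f := fun u : ℝ => ((u + w * I : ℂ) - s)⁻¹ * G (u + w * I))
      (C := A * M * Real.exp (-H ^ 2)) fun u hu => by
        rw [uIoc_of_le hx0] at hu
        have h1 : ‖((u + w * I : ℂ) - s)⁻¹‖ ≤ 1 := by
          rw [norm_inv]
          refine inv_le_one_of_one_le₀ ?_
          refine hH.trans ?_
          rw [← hw]
          have := abs_im_le_norm ((u + w * I : ℂ) - s)
          simpa [hsim] using this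
        have h2 := hkern (u + w * I) A (by
          simp only [add_re, ofReal_re, mul_re, I_re, mul_zero, ofReal_im, I_im, mul_one, sub_self,
            add_zero]
          rw [abs_le]; constructor <;> linarith [hu.1, hu.2]) (hFA u ⟨hu.1.le, hu.2⟩)
        have h3 : (u + w * I : ℂ).im = w := by simp
        rw [h3, ← sq_abs (w - y), hw] at h2
        rw [norm_mul]
        exact (mul_le_of_le_one_left (norm_nonneg _) h1).trans h2
    rwa [abs_of_pos (by linarith)] at h
  have bb := hhor (y - H) (by rw [sub_sub_cancel_left, abs_neg, abs_of_nonneg (by linarith)])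
    fun u hu => (hbt u hu).1
  have bt := hhor (y + H) (by rw [add_sub_cancel_left, abs_of_nonneg (by linarith)])
    fun u hu => (hbt u hu).2
  have hgauss : Continuous fun v : ℝ => Real.exp (-(v - y) ^ 2) := by fun_prop
  have br : ‖Kr‖ ≤ M * √Real.pi / (x₃ - x₂) * B := by
    have h := intervalIntegral.norm_integral_le_of_norm_le (μ := volume) hH0
      (f := fun v : ℝ => ((x₃ + v * I : ℂ) - s)⁻¹ * G (x₃ + v * I))
      (g := fun v => (x₃ - x₂)⁻¹ * (B * M) * Real.exp (-(v - y) ^ 2)) (.of_forall fun v hv => by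
        have h1 : ‖((x₃ + v * I : ℂ) - s)⁻¹‖ ≤ (x₃ - x₂)⁻¹ := by
          rw [norm_inv]
          gcongr
          have := (le_abs_self _).trans (abs_re_le_norm ((x₃ + v * I : ℂ) - s))
          simp [hsre] at this
          linarith
        have h2 := hkern (x₃ + v * I) B (by
          simp only [add_re, ofReal_re, mul_re, I_re, mul_zero, ofReal_im, I_im, mul_one, sub_self,
            add_zero]
          rw [abs_le]; constructor <;> linarith) (hr v ⟨hv.1.le, hv.2⟩)
        have h3 : (x₃ + v * I : ℂ).im = v := by simp
        rw [h3] at h2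
        rw [norm_mul, mul_assoc]
        gcongr) ((hgauss.const_mul _).intervalIntegrable _ _)
    rw [intervalIntegral.integral_const_mul] at h
    refine h.trans ?_
    calc (x₃ - x₂)⁻¹ * (B * M) * ∫ v in (y - H)..(y + H), Real.exp (-(v - y) ^ 2)
        ≤ (x₃ - x₂)⁻¹ * (B * M) * √Real.pi := by
          gcongr
          exact integral_gaussian_translate_le y _ _ hH0
      _ = _ := by ring
  have bl : ‖Kl‖ ≤ M / (x₁ - x₀) *
      ∫ v in (y - H)..(y + H), ‖F (x₀ + v * I)‖ * Real.exp (-(v - y) ^ 2) := by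
    rw [← intervalIntegral.integral_const_mul]
    refine intervalIntegral.norm_integral_le_of_norm_le hH0 (.of_forall fun v hv => ?_) ?_
    · have h1 : ‖((x₀ + v * I : ℂ) - s)⁻¹‖ ≤ (x₁ - x₀)⁻¹ := by
        rw [norm_inv]
        gcongr
        have := (neg_le_abs _).trans (abs_re_le_norm ((x₀ + v * I : ℂ) - s))
        simp [hsre] at this
        linarith
      have h2 := hkern (x₀ + v * I) _ (by
        simp only [add_re, ofReal_re, mul_re, I_re, mul_zero, ofReal_im, I_im, mul_one, sub_self,
          add_zero]
        rw [abs_le]; constructor <;> linarith) le_rfl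
      have h3 : (x₀ + v * I : ℂ).im = v := by simp
      rw [h3] at h2
      rw [norm_mul]
      calc _ ≤ (x₁ - x₀)⁻¹ * (‖F (x₀ + v * I)‖ * M * Real.exp (-(v - y) ^ 2)) := by gcongr
        _ = _ := by ring
    · refine ContinuousOn.intervalIntegrable ?_
      rw [uIcc_of_le hH0]
      refine continuousOn_const.mul (ContinuousOn.mul (fun v hv => ?_) hgauss.continuousOn)
      exact ((hF _ (ml v hv)).continuousAt.comp' (f := fun v : ℝ => (x₀ + v * I : ℂ))
        (by fun_prop)).norm.continuousWithinAt
  have hI0 : 0 ≤ ∫ v in (y - H)..(y + H), ‖F (x₀ + v * I)‖ * Real.exp (-(v - y) ^ 2) :=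
    intervalIntegral.integral_nonneg hH0 fun v _ => by positivity
  set Z := ∫ v in (y - H)..(y + H), ‖F (x₀ + v * I)‖ * Real.exp (-(v - y) ^ 2)
  set g := Real.exp (-H ^ 2) with hg
  have hg0 : 0 < g := Real.exp_pos _
  rw [mul_assoc, le_inv_mul_iff₀' hκ0]
  refine hle.trans ?_
  have c1 : 0 ≤ M / (x₁ - x₀) := by positivity
  have c2 : 0 ≤ M * √Real.pi / (x₃ - x₂) := by positivity
  have c3 : 0 ≤ 2 * d * M := by positivity
  have d1 : 0 ≤ A * g := by positivity
  set a1 := M / (x₁ - x₀)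
  set a2 := M * √Real.pi / (x₃ - x₂)
  have : (a1 + a2 + 2 * d * M) * (Z + B + A * g) = a1 * Z + a2 * B + 2 * (A * M * g * d) +
      (a1 * (B + A * g) + a2 * (Z + A * g) + 2 * d * M * (Z + B)) := by ring
  rw [this]
  have : 0 ≤ a1 * (B + A * g) + a2 * (Z + A * g) + 2 * d * M * (Z + B) := by positivity
  linarith

/-! ### Sets of small density, and bounds for partial sums at most heights -/

/-- The set of `t` with property `P` has upper density at most `ε / 2`: for all large `T` it meets
`[-T, T]` in a set of outer measure at most `ε T`. No measurability is required. -/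
def Rare (ε : ℝ) (P : ℝ → Prop) : Prop :=
  ∀ᶠ T : ℝ in atTop, volume.real {t : ℝ | t ∈ Icc (-T) T ∧ P t} ≤ ε * T

theorem measure_window_ne_top (T : ℝ) (P : ℝ → Prop) :
    volume {t : ℝ | t ∈ Icc (-T) T ∧ P t} ≠ ⊤ :=
  ((measure_mono fun _ ht => ht.1).trans_lt (measure_Icc_lt_top (a := -T) (b := T))).ne

theorem Rare.mono {ε : ℝ} {P Q : ℝ → Prop} (h : Rare ε P) (hQ : ∀ t, Q t → P t) : Rare ε Q := by
  filter_upwards [h] with T hT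
  refine le_trans (measureReal_mono ?_ (measure_window_ne_top T P)) hT
  exact fun t ht => ⟨ht.1, hQ t ht.2⟩

theorem Rare.or {a b : ℝ} {P Q : ℝ → Prop} (hP : Rare a P) (hQ : Rare b Q) :
    Rare (a + b) fun t => P t ∨ Q t := by
  filter_upwards [hP, hQ] with T h1 h2
  have : {t : ℝ | t ∈ Icc (-T) T ∧ (P t ∨ Q t)} =
      {t | t ∈ Icc (-T) T ∧ P t} ∪ {t | t ∈ Icc (-T) T ∧ Q t} := by
    ext t; simp only [mem_ofPred_eq, mem_union]; tauto
  rw [this, add_mul]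
  exact (measureReal_union_le _ _).trans (add_le_add h1 h2)

theorem rare_abs_lt {ε : ℝ} (hε : 0 < ε) (T₁ : ℝ) : Rare ε fun t => |t| < T₁ := by
  filter_upwards [eventually_ge_atTop (2 * |T₁| / ε)] with T hT
  have h1 : volume.real {t : ℝ | t ∈ Icc (-T) T ∧ |t| < T₁} ≤ volume.real (Icc (-|T₁|) |T₁|) := by
    refine measureReal_mono (fun t ht => ?_) measure_Icc_lt_top.ne
    rw [mem_Icc, ← abs_le]
    exact ht.2.le.trans (le_abs_self _)
  rw [Real.volume_real_Icc, max_eq_left (by linarith [abs_nonneg T₁])] at h1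
  rw [div_le_iff₀ hε] at hT
  linarith

/-- Markov's inequality on `[-T, T]`. -/
theorem measure_window_le_of_integral_le {k : ℝ → ℝ} (hk : Continuous k) (h0 : ∀ t, 0 ≤ k t)
    {T M I : ℝ} (hT : 0 ≤ T) (hM : 0 < M) (hI : ∫ t in (-T)..T, k t ≤ I) :
    volume.real {t : ℝ | t ∈ Icc (-T) T ∧ M ≤ k t} ≤ I / M := by
  rw [intervalIntegral.integral_of_le (by linarith), ← integral_Icc_eq_integral_Ioc] at hI
  have h := mul_meas_ge_le_integral_of_nonneg (μ := volume.restrict (Icc (-T) T)) (f := k)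
    (.of_forall h0) (hk.integrableOn_Icc) M
  rw [le_div_iff₀' hM]
  refine le_trans ?_ (h.trans hI)
  have hm : MeasurableSet {t : ℝ | M ≤ k t} := measurableSet_le measurable_const hk.measurable
  rw [measureReal_restrict_apply hm]
  refine mul_le_mul_of_nonneg_left (measureReal_mono ?_ ?_) hM.le
  · exact fun t ht => ⟨ht.2, ht.1⟩
  · exact ((measure_mono inter_subset_right).trans_lt measure_Icc_lt_top).ne

theorem integral_norm_le_one_add {Y : Type*} [TopologicalSpace Y] [CompactSpace Y]
    [MeasurableSpace Y] [OpensMeasurableSpace Y] (μ : Measure Y) [IsProbabilityMeasure μ]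
    {f : Y → ℂ} (hf : Continuous f) :
    ∫ y, ‖f y‖ ∂μ ≤ 1 + ∫ y, ‖f y‖ ^ 2 ∂μ := by
  have hci : ∀ g : Y → ℝ, Continuous g → Integrable g μ := fun g hg =>
    hg.integrable_of_hasCompactSupport (HasCompactSupport.of_compactSpace _)
  have h1 : ∫ y, (1 + ‖f y‖ ^ 2) ∂μ = 1 + ∫ y, ‖f y‖ ^ 2 ∂μ := by
    rw [integral_add (integrable_const _) (hci _ (by fun_prop))]; simp
  rw [← h1]
  refine integral_mono (hci _ (by fun_prop)) (hci _ (by fun_prop)) fun y => ?_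
  simp only
  nlinarith [sq_nonneg (‖f y‖ - 1)]

theorem integral_intervalIntegral_le {Y : Type*} [TopologicalSpace Y] [CompactSpace Y]
    [MeasurableSpace Y] [OpensMeasurableSpace Y] [SecondCountableTopology Y] [T2Space Y]
    {μ : Measure Y} [IsProbabilityMeasure μ]
    {f : Y × ℝ → ℝ} (hf : Continuous f) {L B : ℝ} (hL : 0 ≤ L) (h0 : ∀ p, 0 ≤ f p)
    (hB : ∀ θ, ∫ y, f (y, θ) ∂μ ≤ B) :
    ∫ y, (∫ θ in (0)..L, f (y, θ)) ∂μ ≤ L * B := by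
  have hint : IntegrableOn f (univ ×ˢ Icc 0 L) (μ.prod volume) :=
    hf.continuousOn.integrableOn_compact (isCompact_univ.prod isCompact_Icc)
  rw [IntegrableOn, ← Measure.prod_restrict, Measure.restrict_univ] at hint
  simp only [intervalIntegral.integral_of_le hL, ← integral_Icc_eq_integral_Ioc]
  rw [integral_integral_swap (f := fun y θ => f (y, θ)) hint,
    integral_Icc_eq_integral_Ioc, ← intervalIntegral.integral_of_le hL]
  have h2 := intervalIntegral.norm_integral_le_of_norm_le_const (a := 0) (b := L)
    (f := fun θ => ∫ y, f (y, θ) ∂μ) (C := B) fun θ _ => by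
      rw [Real.norm_of_nonneg (integral_nonneg fun _ => h0 _)]; exact hB θ
  rw [sub_zero, abs_of_nonneg hL] at h2
  exact (le_abs_self _).trans (h2.trans_eq (mul_comm _ _))

namespace MemClassM

variable {E : EulerData} {α β σ₀ : ℝ} {φ : ℂ → ℂ}

/-- The partial sums `partialLog N`, moved vertically by `t`, are bounded on a fixed disc for most
`t`, uniformly in `N`. -/
theorem exists_rare_partialLog (h : MemClassM E α β σ₀ φ) {c r : ℝ} (hr : 0 < r)
    (hcr : α + β + 1 / 2 < c - r) {ε : ℝ} (hε : 0 < ε) :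
    ∃ M : ℝ, ∀ N : ℕ, Rare ε fun t =>
      ∃ z ∈ Metric.closedBall (c + t * I : ℂ) r, M < ‖E.partialLog N z‖ := by
  -- the second moment is used on a larger circle, which still lies in `Re s ≥ x > α + β + 1/2`
  obtain ⟨x, hx1, hx2⟩ := exists_between hcr
  obtain ⟨B, hB0, hB⟩ := h.exists_integral_norm_sq_torusLog_le hx1
  set R := c - x with hR
  have hrR : r < R := by linarith
  have hR0 : 0 < R := hr.trans hrR
  have hre : ∀ (t : ℝ), ∀ z ∈ Metric.closedBall (c + t * I : ℂ) R, x ≤ z.re := fun t z hz => by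
    have h1 := (neg_le_abs _).trans ((abs_re_le_norm (z - (c + t * I))).trans
      (mem_closedBall_iff_norm.1 hz))
    simp at h1
    linarith
  have hcirc : ∀ (t θ : ℝ), x ≤ (circleMap (c + t * I) R θ).re := fun t θ =>
    hre t _ (circleMap_mem_closedBall _ hR0.le θ)
  set I₀ := 2 * Real.pi * (1 + B) with hI₀
  have hI₀' : 0 < I₀ := by positivity
  set M₀ := 2 * (I₀ + 1) / ε with hM₀
  have hM₀' : 0 < M₀ := by positivity
  refine ⟨R / (R - r) * M₀, fun N => ?_⟩
  have hjoint : Continuous fun p : UnitAddTorus (Fin N) × ℝ =>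
      ‖E.torusLog N (circleMap c R p.2) p.1‖ :=
    (h.continuous_torusLog N (s := fun p : UnitAddTorus (Fin N) × ℝ => circleMap c R p.2)
      (by fun_prop) (fun p => by have := hcirc 0 p.2; simp at this; linarith)
      continuous_fst).norm
  set k : UnitAddTorus (Fin N) → ℝ := fun ω =>
    ∫ θ in (0)..(2 * Real.pi), ‖E.torusLog N (circleMap c R θ) ω‖ with hk
  have hkc : Continuous k :=
    intervalIntegral.continuous_parametric_intervalIntegral_of_continuous' hjoint _ _
  have hk0 : ∀ ω, 0 ≤ k ω := fun ω =>
    intervalIntegral.integral_nonneg (by positivity) fun θ _ => norm_nonneg _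
  have hkint : ∫ ω, k ω ∂torusMeasure N ≤ I₀ := by
    refine (integral_intervalIntegral_le hjoint (by positivity) (fun p => norm_nonneg _)
      (B := 1 + B) fun θ => ?_).trans_eq hI₀.symm
    have hcθ : Continuous fun ω => E.torusLog N (circleMap c R θ) ω :=
      h.continuous_torusLog N continuous_const
        (fun _ => by have := hcirc 0 θ; simp at this; linarith) continuous_id
    refine (integral_norm_le_one_add (torusMeasure N) hcθ).trans ?_
    gcongr
    exact hB N (circleMap c R θ) (by have := hcirc 0 θ; simpa using this)
  have hev := (tendsto_mean_flow hkc).eventually_le_const (lt_of_le_of_lt hkint (lt_add_one I₀))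
  filter_upwards [hev, eventually_gt_atTop 0] with T hT hT0
  have hflow : ∀ t : ℝ, k (flow N t) =
      ∫ θ in (0)..(2 * Real.pi), ‖E.partialLog N (circleMap (c + t * I) R θ)‖ := fun t => by
    simp only [hk, torusLog_flow]
    refine intervalIntegral.integral_congr fun θ _ => ?_
    simp only [circleMap]
    congr 2; ring
  rw [one_div, inv_mul_le_iff₀ (by linarith)] at hT
  have hm := measure_window_le_of_integral_le (k := fun t => k (flow N t))
    (hkc.comp (continuous_flow N)) (fun t => hk0 _) hT0.le hM₀' hT
  have e1 : 2 * T * (I₀ + 1) / M₀ = ε * T := by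
    rw [hM₀]; field_simp
  rw [e1] at hm
  refine le_trans (measureReal_mono ?_ (measure_window_ne_top T _)) hm
  intro t ht
  refine ⟨ht.1, ?_⟩
  obtain ⟨z, hz, hMz⟩ := ht.2
  have hle := norm_le_circle_mean hr.le hrR (F := E.partialLog N) (fun w hw =>
    h.analyticAt_partialLog N (by linarith [hre t w hw])) hz
  rw [← hflow] at hle
  have hpos : 0 < R / (R - r) := div_pos hR0 (by linarith)
  exact (lt_of_mul_lt_mul_left (hMz.trans_le hle) hpos.le).le

end MemClassM

/-! ### Bounds for `φ` at most heights -/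

namespace MemClassM

variable {E : EulerData} {α β σ₀ : ℝ} {φ : ℂ → ℂ}

theorem analyticAt_of_order_nonneg (h : MemClassM E α β σ₀ φ) {z : ℂ} (hz : σ₀ ≤ z.re)
    (ho : 0 ≤ meromorphicOrderAt φ z) : AnalyticAt ℂ φ z :=
  (h.meromorphic (show z ∈ {s : ℂ | σ₀ ≤ s.re} from hz))
    |>.meromorphicOrderAt_nonneg_iff_analyticAt.1 ho

/-- The poles have bounded imaginary part. -/
theorem exists_analyticAt (h : MemClassM E α β σ₀ φ) :
    ∃ T₁ : ℝ, ∀ z : ℂ, σ₀ ≤ z.re → T₁ ≤ |z.im| → AnalyticAt ℂ φ z := by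
  obtain ⟨K, hK, -, hp⟩ := h.poles
  obtain ⟨D, hD⟩ := hK.isBounded.exists_norm_le
  refine ⟨D + 1, fun z hz him => h.analyticAt_of_order_nonneg hz ?_⟩
  by_contra! hneg
  have := hD z (hp z hz hneg)
  linarith [abs_im_le_norm z]

theorem continuous_boundary (h : MemClassM E α β σ₀ φ) :
    Continuous fun v : ℝ => φ (σ₀ + v * I) := by
  obtain ⟨K, -, hK, hp⟩ := h.poles
  refine continuous_iff_continuousAt.2 fun v => ?_
  have ha : AnalyticAt ℂ φ (σ₀ + v * I) := by
    refine h.analyticAt_of_order_nonneg (by simp) ?_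
    by_contra! hneg
    have : σ₀ < (σ₀ + v * I : ℂ).re := hK (hp _ (by simp) hneg)
    simp at this
  exact ha.continuousAt.comp' (f := fun v : ℝ => (σ₀ + v * I : ℂ)) (by fun_prop)

/-- The Gaussian mean of `|φ|` on the boundary line around height `t`, cut off at height `2T`. -/
def _root_.EulerLimit.boundaryMean (σ₀ : ℝ) (φ : ℂ → ℂ) (T t : ℝ) : ℝ :=
  ∫ v in (-(2 * T))..(2 * T), ‖φ (σ₀ + v * I)‖ * Real.exp (-((v - t) ^ 2 / 2))

theorem continuous_boundaryMean (h : MemClassM E α β σ₀ φ) (T : ℝ) :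
    Continuous (boundaryMean σ₀ φ T) := by
  unfold boundaryMean
  refine intervalIntegral.continuous_parametric_intervalIntegral_of_continuous' ?_ _ _
  have := (h.continuous_boundary.comp (continuous_snd (X := ℝ) (Y := ℝ))).norm
  exact this.mul (by fun_prop)

/-- The mean of `boundaryMean` is bounded, by Fubini and the mean square of `φ` up to height
`2T`. -/
theorem exists_integral_boundaryMean_le (h : MemClassM E α β σ₀ φ) :
    ∃ B : ℝ, 0 < B ∧ ∀ᶠ T : ℝ in atTop, ∫ t in (-T)..T, boundaryMean σ₀ φ T t ≤ B * T := by
  obtain ⟨c, hc0, hc⟩ := h.meanSquare.exists_pos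
  rw [Asymptotics.isBigOWith_iff] at hc
  have h2 : Tendsto (fun T : ℝ => 2 * T) atTop atTop := tendsto_id.const_mul_atTop two_pos
  refine ⟨√(2 * Real.pi) * (4 + 2 * c), by positivity, ?_⟩
  filter_upwards [h2.eventually hc, eventually_gt_atTop 0] with T hT hT0
  have hcont := h.continuous_boundary.norm
  rw [Real.norm_of_nonneg (intervalIntegral.integral_nonneg (by linarith) fun _ _ => by positivity),
    Real.norm_of_nonneg (by positivity)] at hT
  have hL1 : ∫ v in (-(2 * T))..(2 * T), ‖φ (σ₀ + v * I)‖ ≤ (4 + 2 * c) * T := by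
    calc ∫ v in (-(2 * T))..(2 * T), ‖φ (σ₀ + v * I)‖
        ≤ ∫ v in (-(2 * T))..(2 * T), (1 + ‖φ (σ₀ + v * I)‖ ^ 2) := by
          refine intervalIntegral.integral_mono_on (by linarith) (hcont.intervalIntegrable _ _)
            ((continuous_const.add (hcont.pow 2)).intervalIntegrable _ _) fun v _ => ?_
          nlinarith [sq_nonneg (‖φ (σ₀ + v * I)‖ - 1)]
      _ = 4 * T + ∫ v in (-(2 * T))..(2 * T), ‖φ (σ₀ + v * I)‖ ^ 2 := by
          have hsq : IntervalIntegrable (fun v : ℝ => ‖φ (σ₀ + v * I)‖ ^ 2) volume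
              (-(2 * T)) (2 * T) := (hcont.pow 2).intervalIntegrable _ _
          rw [intervalIntegral.integral_add (by simp) hsq]
          simp; ring
      _ ≤ (4 + 2 * c) * T := by linarith
  have hswap : ∫ t in (-T)..T, boundaryMean σ₀ φ T t = ∫ v in (-(2 * T))..(2 * T),
      ∫ t in (-T)..T, ‖φ (σ₀ + v * I)‖ * Real.exp (-((v - t) ^ 2 / 2)) := by
    refine intervalIntegral_intervalIntegral_swap
      (F := fun t v => ‖φ (σ₀ + v * I)‖ * Real.exp (-((v - t) ^ 2 / 2))) ?_
    have hcc : Continuous (Function.uncurry fun t v : ℝ =>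
        ‖φ (σ₀ + v * I)‖ * Real.exp (-((v - t) ^ 2 / 2))) := by
      have := (h.continuous_boundary.comp (continuous_snd (X := ℝ) (Y := ℝ))).norm
      exact this.mul (by fun_prop)
    exact (hcc.continuousOn.integrableOn_compact
      (isCompact_uIcc.prod isCompact_uIcc)).mono_set
      (prod_mono uIoc_subset_uIcc uIoc_subset_uIcc)
  have hgauss : ∀ v : ℝ, ∫ t in (-T)..T, Real.exp (-((v - t) ^ 2 / 2)) ≤ √(2 * Real.pi) := by
    intro v
    have hg : Integrable fun t : ℝ => Real.exp (-(1 / 2) * t ^ 2) :=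
      integrable_exp_neg_mul_sq (by norm_num)
    have he : ∀ t : ℝ, Real.exp (-((v - t) ^ 2 / 2)) = Real.exp (-(1 / 2) * (t - v) ^ 2) :=
      fun t => by congr 1; ring
    simp only [he]
    rw [intervalIntegral.integral_of_le (by linarith)]
    refine (setIntegral_le_integral (hg.comp_sub_right v)
      (.of_forall fun v => (Real.exp_pos _).le)).trans_eq ?_
    rw [integral_sub_right_eq_self (fun t : ℝ => Real.exp (-(1 / 2) * t ^ 2)) v, integral_gaussian]
    congr 1; ring
  rw [hswap]
  calc ∫ v in (-(2 * T))..(2 * T), ∫ t in (-T)..T,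
        ‖φ (σ₀ + v * I)‖ * Real.exp (-((v - t) ^ 2 / 2))
      ≤ ∫ v in (-(2 * T))..(2 * T), √(2 * Real.pi) * ‖φ (σ₀ + v * I)‖ := by
        refine intervalIntegral.integral_mono_on (by linarith)
          (Continuous.intervalIntegrable ?_ _ _)
          ((hcont.const_mul _).intervalIntegrable _ _) fun v _ => ?_
        · refine intervalIntegral.continuous_parametric_intervalIntegral_of_continuous' ?_ _ _
          have := (h.continuous_boundary.comp (continuous_fst (X := ℝ) (Y := ℝ))).norm
          exact this.mul (by fun_prop)
        · rw [intervalIntegral.integral_const_mul, mul_comm]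
          gcongr
          exact hgauss v
    _ ≤ √(2 * Real.pi) * (4 + 2 * c) * T := by
        rw [intervalIntegral.integral_const_mul, mul_assoc]
        gcongr

/-- In a vertical strip to the right of `Re s = σ₀`, `φ` is controlled by its Gaussian means on
that line: in the Cauchy estimate on a rectangle of height comparable to `|t|`, the horizontal
sides contribute `O(1)` by the polynomial growth of `φ`. -/
theorem exists_norm_le_boundaryMean (h : MemClassM E α β σ₀ φ) {c r : ℝ} (hr : 0 < r)
    (hcr : σ₀ < c - r) :
    ∃ K T₁ : ℝ, 0 < K ∧ ∀ T t : ℝ, 3 * r ≤ T → |t| ≤ T → T₁ ≤ |t| →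
      ∀ z ∈ Metric.closedBall (c + t * I : ℂ) r, ‖φ z‖ ≤ K * (boundaryMean σ₀ φ T t + 1) := by
  obtain ⟨Bl, hBl⟩ := h.exists_norm_eulerLog_le
  obtain ⟨Ta, hTa⟩ := h.exists_analyticAt
  obtain ⟨C, hC, D, Tg, hg⟩ := h.growth
  set x₃ := max (c + r) (α + β + 2) + 1 with hx₃
  have hx3a : c + r < x₃ := by linarith [le_max_left (c + r) (α + β + 2)]
  have hx3b : α + β + 2 < x₃ := by linarith [le_max_right (c + r) (α + β + 2)]
  obtain ⟨K, hK, hrect⟩ := exists_norm_le_rectangle hcr (show c - r ≤ c + r by linarith) hx3a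
  set P := Real.exp (r ^ 2) + Real.exp Bl + |D| * Real.exp (4 * C ^ 2) with hP
  have hP0 : 0 < P := by positivity
  set T₀ := max (max Ta Tg) 1 with hT₀
  have hT0a : Ta ≤ T₀ := (le_max_left _ _).trans (le_max_left _ _)
  have hT0g : Tg ≤ T₀ := (le_max_right _ _).trans (le_max_left _ _)
  have hT01 : 1 ≤ T₀ := le_max_right _ _
  refine ⟨K * P, 2 * T₀ + r, by positivity, fun T t hT htT ht z hz => ?_⟩
  set y := z.im with hy
  have hzn := mem_closedBall_iff_norm.1 hz
  have hzre : |z.re - c| ≤ r := by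
    have := (abs_re_le_norm (z - (c + t * I))).trans hzn
    simpa using this
  have hzim : |y - t| ≤ r := by
    have := (abs_im_le_norm (z - (c + t * I))).trans hzn
    simpa using this
  rw [abs_le] at hzre
  have hyt : |t| - r ≤ |y| := by
    have := abs_sub_abs_le_abs_sub t y
    rw [abs_sub_comm] at this
    linarith
  have hyt' : |y| ≤ |t| + r := by
    have := abs_sub_abs_le_abs_sub y t
    linarith
  -- with this height of the rectangle, all ordinates in it lie between `|y| / 2` and `3 |y| / 2`
  set H := |y| / 2 with hH
  have hHT : T₀ ≤ H := by rw [hH]; linarith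
  have hH1 : 1 ≤ H := hT01.trans hHT
  have hv : ∀ v ∈ Icc (y - H) (y + H), T₀ ≤ |v| ∧ |v| ≤ 3 * H := by
    intro v hv
    have h1 : |v - y| ≤ H := abs_le.2 ⟨by linarith [hv.1], by linarith [hv.2]⟩
    have h2 := abs_sub_abs_le_abs_sub y v
    have h3 := abs_sub_abs_le_abs_sub v y
    rw [abs_sub_comm] at h2
    constructor <;> linarith
  have hz_eq : (z.re + y * I : ℂ) = z := re_add_im z
  have hgrow : ∀ u ∈ Icc σ₀ x₃, ∀ v ∈ Icc (y - H) (y + H),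
      ‖φ (u + v * I)‖ ≤ |D| * (4 * H) ^ C := by
    intro u hu v hvm
    obtain ⟨h1, h2⟩ := hv v hvm
    refine (hg u v hu.1 (hT0g.trans h1)).trans ?_
    gcongr
    · exact le_abs_self D
    · linarith
  have main := hrect φ z.re y H (|D| * (4 * H) ^ C) (Real.exp Bl) (by linarith) (by linarith) hH1
    (by positivity) (Real.exp_pos _).le
    (fun w hw => hTa w hw.1.1 (hT0a.trans (hv _ hw.2).1))
    (fun v _ => by
      rw [h.eq_exp_eulerLog (by simp; linarith)]
      refine (norm_exp_le_exp_norm _).trans (Real.exp_le_exp.2 (hBl _ ?_))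
      simp; linarith)
    fun u hu => ⟨hgrow u hu _ ⟨le_rfl, by linarith⟩, hgrow u hu _ ⟨by linarith, le_rfl⟩⟩
  rw [hz_eq] at main
  -- the Gaussian decay of the kernel beats the polynomial growth on the horizontal sides
  have hA : |D| * (4 * H) ^ C * Real.exp (-H ^ 2) ≤ |D| * Real.exp (4 * C ^ 2) := by
    have h1 : (4 * H) ^ C ≤ Real.exp (4 * H * C) := by
      rw [Real.exp_mul]
      gcongr
      linarith [Real.add_one_le_exp (4 * H)]
    calc |D| * (4 * H) ^ C * Real.exp (-H ^ 2)
        ≤ |D| * Real.exp (4 * H * C) * Real.exp (-H ^ 2) := by gcongr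
      _ = |D| * Real.exp (4 * H * C + -H ^ 2) := by rw [mul_assoc, ← Real.exp_add]
      _ ≤ |D| * Real.exp (4 * C ^ 2) := by
        gcongr
        nlinarith [sq_nonneg (H - 2 * C)]
  have hcont := h.continuous_boundary.norm
  have hbm0 : 0 ≤ boundaryMean σ₀ φ T t :=
    intervalIntegral.integral_nonneg (by linarith) fun v _ => by positivity
  have hZ : ∫ v in (y - H)..(y + H), ‖φ (σ₀ + v * I)‖ * Real.exp (-(v - y) ^ 2) ≤
      Real.exp (r ^ 2) * boundaryMean σ₀ φ T t := by
    have hyH : |y| + H ≤ 2 * T := by rw [hH]; linarith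
    have hab := abs_le.1 (le_refl |y|)
    calc ∫ v in (y - H)..(y + H), ‖φ (σ₀ + v * I)‖ * Real.exp (-(v - y) ^ 2)
        ≤ ∫ v in (y - H)..(y + H),
            Real.exp (r ^ 2) * (‖φ (σ₀ + v * I)‖ * Real.exp (-((v - t) ^ 2 / 2))) := by
          refine intervalIntegral.integral_mono_on (by linarith)
            ((hcont.mul (by fun_prop)).intervalIntegrable _ _)
            ((continuous_const.mul (hcont.mul (by fun_prop))).intervalIntegrable _ _) fun v _ => ?_
          rw [mul_left_comm, ← Real.exp_add]
          gcongr
          have : (y - t) ^ 2 ≤ r ^ 2 := by rw [← sq_abs]; gcongr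
          nlinarith [sq_nonneg ((v - y) - (y - t))]
      _ ≤ ∫ v in (-(2 * T))..(2 * T),
            Real.exp (r ^ 2) * (‖φ (σ₀ + v * I)‖ * Real.exp (-((v - t) ^ 2 / 2))) := by
          refine intervalIntegral.integral_mono_interval (by linarith) (by linarith) (by linarith)
            (.of_forall fun v => by simp only [Pi.zero_apply]; positivity)
            ((continuous_const.mul (hcont.mul (by fun_prop))).intervalIntegrable _ _)
      _ = _ := by rw [intervalIntegral.integral_const_mul, boundaryMean]
  refine main.trans ?_
  rw [mul_assoc K P]
  refine mul_le_mul_of_nonneg_left ?_ hK.le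
  have q1 := Real.exp_pos (r ^ 2)
  have q2 := Real.exp_pos Bl
  have q3 : 0 ≤ |D| * Real.exp (4 * C ^ 2) := by positivity
  have : P * (boundaryMean σ₀ φ T t + 1) = Real.exp (r ^ 2) * boundaryMean σ₀ φ T t + Real.exp Bl +
      |D| * Real.exp (4 * C ^ 2) + (Real.exp (r ^ 2) + (Real.exp Bl + |D| * Real.exp (4 * C ^ 2)) *
        boundaryMean σ₀ φ T t) := by rw [hP]; ring
  rw [this]
  have : 0 ≤ Real.exp (r ^ 2) + (Real.exp Bl + |D| * Real.exp (4 * C ^ 2)) *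
        boundaryMean σ₀ φ T t := by positivity
  linarith

/-- `φ`, moved vertically by `t`, is bounded on a fixed disc for most `t`. -/
theorem exists_rare_phi (h : MemClassM E α β σ₀ φ) {c r : ℝ} (hr : 0 < r) (hcr : σ₀ < c - r)
    {ε : ℝ} (hε : 0 < ε) :
    ∃ M : ℝ, Rare ε fun t => ∃ z ∈ Metric.closedBall (c + t * I : ℂ) r, M < ‖φ z‖ := by
  obtain ⟨K, T₁, hK, hφ⟩ := h.exists_norm_le_boundaryMean hr hcr
  obtain ⟨B, hB, hBT⟩ := h.exists_integral_boundaryMean_le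
  set M₀ := 2 * B / ε with hM₀
  have hM₀' : 0 < M₀ := by positivity
  refine ⟨K * (M₀ + 1), ?_⟩
  filter_upwards [hBT, rare_abs_lt (half_pos hε) T₁, eventually_ge_atTop (3 * r)] with T hT hT1 hT2
  have hT0 : 0 ≤ T := by linarith
  have hm := measure_window_le_of_integral_le (h.continuous_boundaryMean T) (fun t =>
    intervalIntegral.integral_nonneg (by linarith) fun v _ => by positivity) hT0 hM₀' hT
  have e1 : B * T / M₀ = ε / 2 * T := by rw [hM₀]; field_simp
  rw [e1] at hm
  have hsub : {t : ℝ | t ∈ Icc (-T) T ∧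
      ∃ z ∈ Metric.closedBall (c + t * I : ℂ) r, K * (M₀ + 1) < ‖φ z‖} ⊆
      {t | t ∈ Icc (-T) T ∧ |t| < T₁} ∪ {t | t ∈ Icc (-T) T ∧ M₀ ≤ boundaryMean σ₀ φ T t} := by
    rintro t ⟨ht, z, hz, hMz⟩
    by_cases h1 : |t| < T₁
    · exact Or.inl ⟨ht, h1⟩
    · refine Or.inr ⟨ht, ?_⟩
      have := hMz.trans_le (hφ T t hT2 (abs_le.2 ht) (not_lt.1 h1) z hz)
      have := lt_of_mul_lt_mul_left this hK.le
      linarith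
  refine (measureReal_mono hsub (measure_union_lt_top
    (measure_window_ne_top T _).lt_top (measure_window_ne_top T _).lt_top).ne).trans ?_
  refine (measureReal_union_le _ _).trans ?_
  linarith

end MemClassM

/-! ### Approximation of `log φ` by partial sums -/

theorem convex_ray_inter (s : ℂ) (b : ℝ) : Convex ℝ (ray s ∩ {z : ℂ | b < z.re}) := by
  have h1 : ray s ∩ {z : ℂ | b < z.re} =
      {z | s.re ≤ z.re} ∩ {z | z.im = s.im} ∩ {z | b < z.re} := by
    ext z; simp [ray]
  rw [h1]
  exact ((convex_halfSpace_re_ge _).inter (convex_hyperplane imLm.isLinear _)).inter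
    (convex_halfSpace_re_gt _)

namespace MemClassM

variable {E : EulerData} {α β σ₀ : ℝ} {φ : ℂ → ℂ}

/-- If `φ` divided by its partial product is close to `1` along the ray to the right of `s`, then
`s` lies in the cut domain and `log φ(s)` is close to the partial sum of the logarithm. -/
theorem mem_cutDomain_and_norm_logPhi_sub_le (h : MemClassM E α β σ₀ φ) {s : ℂ} (hs : σ₀ < s.re)
    {N : ℕ} {η : ℝ} (hη : η ≤ 1 / 2) (hφ : ∀ z ∈ ray s, AnalyticAt ℂ φ z)
    (hclose : ∀ z ∈ ray s, ‖φ z * exp (-E.partialLog N z) - 1‖ ≤ η)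
    (htail : ∀ z : ℂ, α + β + 2 ≤ z.re → ‖E.eulerLog z - E.partialLog N z‖ ≤ 1) :
    s ∈ cutDomain σ₀ φ ∧ ‖logPhi E (α + β + 1) s - E.partialLog N s‖ ≤ 4 * η := by
  have hσ := h.le_sigma
  set f : ℂ → ℂ := fun z => φ z * exp (-E.partialLog N z) with hf
  set L : ℂ → ℂ := fun z => E.partialLog N z + Complex.log (f z) with hL
  have hf1 : ∀ z ∈ ray s, ‖1 - f z‖ ≤ η := fun z hz => by rw [norm_sub_rev]; exact hclose z hz
  have hslit : ∀ z ∈ ray s, f z ∈ slitPlane := fun z hz => by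
    have := one_sub_mem_slitPlane (w := 1 - f z) (by linarith [hf1 z hz])
    rwa [sub_sub_cancel] at this
  have hSa : ∀ z ∈ ray s, AnalyticAt ℂ (E.partialLog N) z := fun z hz =>
    h.analyticAt_partialLog N (by linarith [hz.1])
  have hLa : AnalyticOnNhd ℂ L (ray s) := fun z hz =>
    (hSa z hz).add (AnalyticAt.clog ((hφ z hz).mul (hSa z hz).neg.cexp) (hslit z hz))
  have hsm : s ∈ ray s := ⟨le_rfl, rfl⟩
  have hfar : ∀ z : ℂ, α + β + 2 ≤ z.re → L z = E.eulerLog z := fun z hz => by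
    -- `log ∘ exp` is the identity here, as the imaginary part of the tail is at most `1 < π`
    have him := (abs_im_le_norm _).trans (htail z hz)
    rw [abs_le] at him
    simp only [hL, hf]
    rw [h.eq_exp_eulerLog (by linarith), ← Complex.exp_add, ← sub_eq_add_neg,
      log_exp (by linarith [Real.pi_gt_three]) (by linarith [Real.pi_gt_three])]
    ring
  have hval : IsLogValue E (α + β + 1) s (L s) := by
    refine ⟨L, hLa, fun z hz hzre => ?_, rfl⟩
    set z₀ : ℂ := ⟨max s.re (α + β + 2) + 1, s.im⟩ with hz₀
    have h1 : s.re < z₀.re := by have := le_max_left s.re (α + β + 2); simp only [hz₀]; linarith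
    have h2 : α + β + 2 < z₀.re := by
      have := le_max_right s.re (α + β + 2); simp only [hz₀]; linarith
    refine AnalyticOnNhd.eqOn_of_preconnected_of_eventuallyEq
      (U := ray s ∩ {z : ℂ | α + β + 1 < z.re}) (fun w hw => hLa w hw.1)
      (fun w hw => h.analyticOnNhd_eulerLog w hw.2) (convex_ray_inter s _).isPreconnected
      (z₀ := z₀) ⟨⟨h1.le, rfl⟩, show α + β + 1 < z₀.re by linarith⟩ ?_ ⟨hz, hzre⟩
    have hopen : IsOpen {w : ℂ | α + β + 2 < w.re} := isOpen_lt continuous_const continuous_re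
    filter_upwards [hopen.mem_nhds h2] with w hw
    exact hfar w (le_of_lt hw)
  refine ⟨⟨hs.le, ?_⟩, ?_⟩
  · simp only [mem_iUnion, not_exists]
    rintro ρ ⟨hρ, hord⟩ hsl
    have hρm : ρ ∈ ray s := ⟨hsl.2.1, hsl.2.2.symm⟩
    have hne : φ ρ ≠ 0 := fun h0 => slitPlane_ne_zero (hslit ρ hρm) (by simp [hf, h0])
    have := (h.meromorphic (show ρ ∈ {s : ℂ | σ₀ ≤ s.re} from hρ)).meromorphicOrderAt_eq_zero_iff.2
      hne
    rw [this] at hord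
    simp at hord
  · rw [logPhi_eq hval, hL, add_sub_cancel_left]
    have := norm_log_one_sub_le (w := 1 - f s) (by linarith [hf1 s hsm])
    rw [sub_sub_cancel] at this
    linarith [hf1 s hsm]

/-- The key approximation: for most `t`, the point `σ + it` lies in the cut domain and
`log φ(σ + it)` is close to a partial sum of the logarithmic Euler product. The quotient of `φ` by
its partial product is bounded on large discs for most `t`, and close to `1` in the half-plane of
absolute convergence. -/
theorem exists_forall_rare_not_close (h : MemClassM E α β σ₀ φ) {σ : ℝ} (hσ : σ₀ < σ)
    {δ ε : ℝ} (hδ : 0 < δ) (hε : 0 < ε) :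
    ∃ N₀ : ℕ, ∀ N ≥ N₀, Rare ε fun t =>
      ¬((σ + t * I : ℂ) ∈ cutDomain σ₀ φ ∧
        ‖logPhi E (α + β + 1) (σ + t * I) - E.partialLog N (σ + t * I)‖ ≤ δ) := by
  have hle := h.le_sigma
  obtain ⟨σ₁, hσ1, hσ2⟩ := exists_between hσ
  -- the disc of radius `1` around `c + it` lies in the half-plane `Re s ≥ α + β + 2`
  set c := max (α + β + 1) σ + 2 with hc
  have hc1 : α + β + 3 ≤ c := by linarith [le_max_left (α + β + 1) σ]
  have hc2 : σ + 2 ≤ c := by linarith [le_max_right (α + β + 1) σ]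
  have hr3 : 0 < c - σ₁ := by linarith
  obtain ⟨M₁, hM₁⟩ := h.exists_rare_phi (c := c) (r := c - σ₁) hr3 (by linarith)
    (ε := ε / 3) (by positivity)
  obtain ⟨M₂, hM₂⟩ := h.exists_rare_partialLog (c := c) (r := c - σ₁) hr3 (by linarith)
    (ε := ε / 3) (by positivity)
  set η := min (1 / 2) (δ / 4) with hη
  have hη0 : 0 < η := by positivity
  obtain ⟨δ', hδ', hthree⟩ := exists_forall_norm_le_of_three_circles one_pos
    (show 1 < c - σ by linarith) (show c - σ < c - σ₁ by linarith) (M₁ * Real.exp M₂ + 1) hη0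
  set κ := min 1 (min (δ' / 2) (η / 2)) with hκ
  have hκ0 : 0 < κ := by positivity
  obtain ⟨N₀, hN₀⟩ := h.exists_forall_norm_tail_le hκ0
  obtain ⟨T₁, hT₁⟩ := h.exists_analyticAt
  refine ⟨N₀, fun N hN => ?_⟩
  have hrare := ((rare_abs_lt (ε := ε / 3) (by positivity) (T₁ + (c - σ₁))).or hM₁).or (hM₂ N)
  rw [add_thirds] at hrare
  refine hrare.mono fun t ht => ?_
  contrapose! ht
  obtain ⟨⟨ht1, ht2⟩, ht3⟩ := ht
  have hfar : ∀ z : ℂ, α + β + 2 ≤ z.re → ‖φ z * exp (-E.partialLog N z) - 1‖ ≤ 2 * κ := by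
    intro z hz
    have hk := hN₀ N hN z hz
    rw [h.eq_exp_eulerLog (by linarith), ← Complex.exp_add, ← sub_eq_add_neg]
    exact (norm_exp_sub_one_le (hk.trans (min_le_left _ _))).trans (by linarith)
  have hκ1 : κ ≤ 1 := min_le_left _ _
  have hκ2 : 2 * κ ≤ δ' := by
    have : κ ≤ δ' / 2 := (min_le_right _ _).trans (min_le_left _ _)
    linarith
  have hκ3 : 2 * κ ≤ η := by
    have : κ ≤ η / 2 := (min_le_right _ _).trans (min_le_right _ _)
    linarith
  have hball : ∀ r : ℝ, ∀ z ∈ Metric.closedBall (c + t * I : ℂ) r,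
      c - r ≤ z.re ∧ |t| - r ≤ |z.im| := by
    intro r z hz
    have hz' := mem_closedBall_iff_norm.1 hz
    have h1 := (neg_le_abs _).trans ((abs_re_le_norm _).trans hz')
    have h2 := (abs_im_le_norm _).trans hz'
    simp only [sub_re, sub_im, add_re, add_im, ofReal_re, ofReal_im, mul_re, mul_im, I_re, I_im,
      mul_zero, mul_one, sub_zero, add_zero, zero_add] at h1 h2
    have h3 := abs_sub_abs_le_abs_sub t z.im
    rw [abs_sub_comm] at h3
    exact ⟨by linarith, by linarith⟩
  have hmid := hthree (fun z => φ z * exp (-E.partialLog N z) - 1) (c + t * I)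
    (fun z hz => by
      obtain ⟨hz1, hz2⟩ := hball _ z hz
      exact ((hT₁ z (by linarith) (by linarith)).mul
        (h.analyticAt_partialLog N (by linarith)).neg.cexp).sub analyticAt_const)
    (fun z hz => by
      refine (norm_sub_le _ _).trans ?_
      rw [norm_one, norm_mul]
      gcongr
      · exact (norm_nonneg _).trans (ht2 z hz)
      · exact ht2 z hz
      · refine (norm_exp_le_exp_norm _).trans (Real.exp_le_exp.2 ?_)
        rw [norm_neg]
        exact ht3 z hz)
    (fun z hz => (hfar z (by linarith [(hball _ z hz).1])).trans hκ2)
  have hsre : (σ + t * I : ℂ).re = σ := by simp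
  have hsim : (σ + t * I : ℂ).im = t := by simp
  have key := h.mem_cutDomain_and_norm_logPhi_sub_le (s := σ + t * I) (N := N) (η := η)
    (by rw [hsre]; exact hσ) (min_le_left _ _)
    (fun z hz => by
      have h1 := hz.1
      have h2 := hz.2
      rw [hsre] at h1
      rw [hsim] at h2
      exact hT₁ z (by linarith) (by rw [h2]; linarith))
    (fun z hz => by
      have h1 := hz.1
      have h2 := hz.2
      rw [hsre] at h1
      rw [hsim] at h2
      -- the ray runs through the middle disc up to `c + it`, and then in the far half-plane
      by_cases hzc : z.re ≤ c
      · refine hmid z ?_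
        rw [mem_closedBall_iff_norm]
        have : z - (c + t * I) = ((z.re - c : ℝ) : ℂ) := by
          apply Complex.ext <;> simp [h2]
        rw [this, norm_real, Real.norm_eq_abs, abs_le]
        constructor <;> linarith
      · exact (hfar z (by linarith)).trans hκ3)
    (fun z hz => (hN₀ N hN z hz).trans hκ1)
  refine ⟨key.1, key.2.trans ?_⟩
  have : η ≤ δ / 4 := min_le_right _ _
  linarith

end MemClassM

/-! ### Concentration functions: no local factor has an atom -/

/-- The degree of `A_n` is the sum of the degrees of its factors, so a nonzero coefficient makes it
positive. -/
theorem EulerData.A_ne_one (E : EulerData) {n : ℕ} {j : Fin (E.g n)} (hj : E.a n j ≠ 0) :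
    E.A n ≠ 1 := by
  intro h1
  have hne : ∀ i : Fin (E.g n),
      (1 - Polynomial.C (E.a n i) * Polynomial.X ^ (E.f n i) : Polynomial ℂ) ≠ 0 := fun i h0 => by
    have := congrArg (Polynomial.eval 0) h0
    simp [zero_pow (E.f_pos n i).ne'] at this
  have hdeg : (E.A n).natDegree = _ := Polynomial.natDegree_prod _ _ fun i _ => hne i
  rw [h1, Polynomial.natDegree_one] at hdeg
  have h0 := (Finset.sum_eq_zero_iff.1 hdeg.symm) j (Finset.mem_univ j)
  have hc : (1 - Polynomial.C (E.a n j) * Polynomial.X ^ (E.f n j) : Polynomial ℂ).coeff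
      (E.f n j) ≠ 0 := by
    simp [Polynomial.coeff_one, (E.f_pos n j).ne', hj]
  have := Polynomial.le_natDegree_of_ne_zero hc
  have := E.f_pos n j
  omega

theorem toCircle_coe_eq_exp (x : ℝ) :
    (AddCircle.toCircle (x : UnitAddCircle) : ℂ) = exp (2 * Real.pi * I * x) := by
  have h := fourier_coe_apply (T := (1 : ℝ)) (n := 1) (x := x)
  rw [fourier_one] at h
  simpa using h

namespace MemClassM

variable {E : EulerData} {α β σ₀ : ℝ} {φ : ℂ → ℂ}

/-- No real linear functional `w ↦ Re (u w)` is constant on the closed curve described by a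
nontrivial local logarithm: since `ℓ(0) = 0`, both `ℓ` and `ℓ²` have mean zero on the circle, so
the constant is `0` and `|u ℓ|² = 2 (Re u ℓ)² - Re (u ℓ)²` has mean zero. -/
theorem exists_re_mul_localLog_ne (h : MemClassM E α β σ₀ φ) {n : ℕ} {j : Fin (E.g n)}
    (hj : E.a n j ≠ 0) {s : ℂ} (hs : α + β + 1 / 2 ≤ s.re) {u : ℂ} (hu : u ≠ 0) (y : ℝ) :
    ∃ x : UnitAddCircle,
      (u * E.localLog n ((prm n : ℂ) ^ (-s) * AddCircle.toCircle x)).re ≠ y := by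
  by_contra! hall
  have hα := h.alpha_nonneg
  set z := (prm n : ℂ) ^ (-s) with hz
  set w : UnitAddCircle → ℂ := fun x => u * E.localLog n (z * AddCircle.toCircle x) with hw
  have hwc : Continuous w :=
    (h.continuous_localLog_circle n continuous_const (fun _ => hs) continuous_id).const_mul u
  have hci : ∀ {F : Type} [NormedAddCommGroup F] (f : UnitAddCircle → F), Continuous f →
      Integrable f AddCircle.haarAddCircle := fun f hf =>
    hf.integrable_of_hasCompactSupport (HasCompactSupport.of_compactSpace _)
  have han : ∀ v, ‖v‖ ≤ ‖z‖ → AnalyticAt ℂ (E.localLog n) v := fun v hv =>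
    h.analyticAt_localLog (hv.trans (norm_prm_cpow_le (by linarith)))
  have hm1 : ∫ x, w x ∂AddCircle.haarAddCircle = 0 := by
    rw [hw, integral_const_mul, integral_haarAddCircle_of_analytic han, E.localLog_zero, mul_zero]
  have hm2 : ∫ x, w x ^ 2 ∂AddCircle.haarAddCircle = 0 := by
    have := integral_haarAddCircle_of_analytic (G := fun v => (u * E.localLog n v) ^ 2) (z := z)
      fun v hv => ((analyticAt_const.mul (han v hv)).pow 2)
    simpa using this
  have hy : y = 0 := by
    have h1 := reCLM.integral_comp_comm (hci w hwc)
    have hre : ∀ x, reCLM (w x) = y := hall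
    simp only [hre, integral_const, probReal_univ, one_smul] at h1
    rw [h1, ← zero_re, ← hm1]
    rfl
  have hnorm : ∀ x, ‖w x‖ ^ 2 = -(w x ^ 2).re := fun x => by
    have hx : (w x).re = 0 := by rw [← hy]; exact hall x
    generalize w x = v at hx ⊢
    rw [← normSq_eq_norm_sq, normSq_apply, sq, mul_re, hx]
    ring
  have hint : ∫ x, ‖w x‖ ^ 2 ∂AddCircle.haarAddCircle = 0 := by
    have h1 := reCLM.integral_comp_comm (hci (fun x => w x ^ 2) (hwc.pow 2))
    simp only [reCLM_apply, hm2, zero_re] at h1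
    simp only [hnorm]
    rw [integral_neg, h1, neg_zero]
  have hae := (integral_eq_zero_iff_of_nonneg (fun x => sq_nonneg ‖w x‖)
    (hci _ (hwc.norm.pow 2))).1 hint
  have hzero : (fun x => ‖w x‖ ^ 2) = 0 :=
    (Continuous.ae_eq_iff_eq _ (hwc.norm.pow 2) continuous_const).1 hae
  have hA : ∀ x : UnitAddCircle, (E.A n - 1).IsRoot (z * AddCircle.toCircle x) := fun x => by
    have hwx : w x = 0 := by simpa using congrFun hzero x
    have hl : E.localLog n (z * AddCircle.toCircle x) = 0 := (mul_eq_zero.1 hwx).resolve_left hu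
    have := h.exp_neg_localLog (n := n) (z := z * AddCircle.toCircle x)
      (norm_prm_cpow_mul_le (by linarith) _)
    rw [hl, neg_zero, Complex.exp_zero] at this
    simp [Polynomial.IsRoot, ← this]
  refine E.A_ne_one hj (sub_eq_zero.1 (Polynomial.eq_zero_of_infinite_isRoot _ ?_))
  have hz0 : z ≠ 0 := by
    rw [hz, cpow_ne_zero_iff]
    exact Or.inl (by exact_mod_cast (prm_prime n).ne_zero)
  have hinj : Function.Injective fun x : UnitAddCircle => z * (AddCircle.toCircle x : ℂ) :=
    fun x x' hxx => AddCircle.injective_toCircle one_ne_zero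
      (Subtype.ext (mul_left_cancel₀ hz0 hxx))
  have : Infinite UnitAddCircle := by
    have : Infinite (Ico (0 : ℝ) (0 + 1)) := (Ico_infinite (by norm_num)).to_subtype
    exact Infinite.of_injective _ (AddCircle.equivIco (1 : ℝ) 0).symm.injective
  exact (infinite_range_of_injective hinj).mono (by rintro _ ⟨x, rfl⟩; exact hA x)

/-- The real linear functionals of a nontrivial local logarithm have no atoms: on the circle they
are real analytic and nonconstant. -/
theorem ae_re_mul_localLog_ne (h : MemClassM E α β σ₀ φ) {n : ℕ} {j : Fin (E.g n)}
    (hj : E.a n j ≠ 0) {s : ℂ} (hs : α + β + 1 / 2 ≤ s.re) {u : ℂ} (hu : u ≠ 0) (y : ℝ) :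
    ∀ᵐ x : UnitAddCircle ∂AddCircle.haarAddCircle,
      (u * E.localLog n ((prm n : ℂ) ^ (-s) * AddCircle.toCircle x)).re ≠ y := by
  have hα := h.alpha_nonneg
  set g : UnitAddCircle → ℝ := fun x =>
    (u * E.localLog n ((prm n : ℂ) ^ (-s) * AddCircle.toCircle x)).re with hg
  have hgc : Continuous g := continuous_re.comp
    ((h.continuous_localLog_circle n continuous_const (fun _ => hs) continuous_id).const_mul u)
  have han : AnalyticOnNhd ℝ (fun θ : ℝ => g (θ : UnitAddCircle) - y) univ := by
    intro θ _
    refine AnalyticAt.sub ?_ analyticAt_const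
    simp only [hg, toCircle_coe_eq_exp]
    have h1 : AnalyticAt ℝ (fun θ : ℝ => (prm n : ℂ) ^ (-s) * exp (2 * Real.pi * I * θ)) θ := by
      refine analyticAt_const.mul (AnalyticAt.fun_comp (g := exp) ?_ ?_)
      · exact analyticAt_cexp.restrictScalars
      · exact analyticAt_const.mul (ofRealCLM.analyticAt θ)
    have h2 : AnalyticAt ℝ (E.localLog n) ((prm n : ℂ) ^ (-s) * exp (2 * Real.pi * I * θ)) := by
      refine (h.analyticAt_localLog ?_).restrictScalars
      rw [← toCircle_coe_eq_exp]
      exact norm_prm_cpow_mul_le (by linarith) _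
    have h3 := AnalyticAt.fun_comp (f := fun θ : ℝ => (prm n : ℂ) ^ (-s) *
      exp (2 * Real.pi * I * θ)) h2 h1
    have h4 : AnalyticAt ℝ (fun θ : ℝ => u * E.localLog n ((prm n : ℂ) ^ (-s) *
        exp (2 * Real.pi * I * θ))) θ := analyticAt_const.mul h3
    exact (reCLM.analyticAt _).fun_comp h4
  have hvol : (volume : Measure UnitAddCircle) = AddCircle.haarAddCircle := by
    rw [AddCircle.volume_eq_smul_haarAddCircle, ENNReal.ofReal_one, one_smul]
  rw [← hvol, ← (UnitAddCircle.measurePreserving_mk 0).map_eq, ae_map_iff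
    (UnitAddCircle.measurePreserving_mk 0).aemeasurable
    ((isOpen_ne_fun hgc continuous_const).measurableSet)]
  rcases han.eqOn_zero_or_eventually_ne_zero_of_preconnected isPreconnected_univ with h0 | h0
  · exfalso
    obtain ⟨x, hx⟩ := h.exists_re_mul_localLog_ne hj hs hu y
    obtain ⟨θ, rfl⟩ := QuotientAddGroup.mk_surjective x
    exact hx (sub_eq_zero.1 (h0 (mem_univ θ)))
  · have := ae_restrict_le_codiscreteWithin (μ := (volume : Measure ℝ)) MeasurableSet.univ h0
    rw [Measure.restrict_univ] at this
    refine ae_restrict_of_ae ?_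
    filter_upwards [this] with θ hθ
    exact fun h1 => hθ (sub_eq_zero.2 h1)

end MemClassM

/-- A continuous bump at `0`: at least `1` on `[-δ, δ]`, supported in `[-2δ, 2δ]`. -/
def tent (δ v : ℝ) : ℝ := max 0 (2 - |v| / δ)

theorem continuous_tent (δ : ℝ) : Continuous (tent δ) := by unfold tent; fun_prop

theorem tent_nonneg (δ v : ℝ) : 0 ≤ tent δ v := le_max_left _ _

theorem tent_le_two {δ : ℝ} (hδ : 0 < δ) (v : ℝ) : tent δ v ≤ 2 :=
  max_le (by norm_num) (by have : 0 ≤ |v| / δ := by positivity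
                           linarith)

theorem one_le_tent {δ v : ℝ} (hδ : 0 < δ) (hv : |v| ≤ δ) : 1 ≤ tent δ v := by
  refine le_trans ?_ (le_max_right _ _)
  have := (div_le_one hδ).2 hv
  linarith

theorem tent_eq_zero {δ v : ℝ} (hδ : 0 < δ) (hv : 2 * δ ≤ |v|) : tent δ v = 0 := by
  have := (le_div_iff₀ hδ).2 hv
  exact max_eq_left (by linarith)

theorem tent_mono {δ δ' : ℝ} (hδ : 0 < δ) (hle : δ ≤ δ') (v : ℝ) : tent δ v ≤ tent δ' v := by
  unfold tent
  gcongr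

/-- A continuous function without atoms has a uniformly small concentration function. -/
theorem exists_forall_integral_tent_le {Y : Type*} [TopologicalSpace Y] [CompactSpace Y]
    [MeasurableSpace Y] [BorelSpace Y] (μ : Measure Y) [IsProbabilityMeasure μ] {g : Y → ℝ}
    (hg : Continuous g) (hna : ∀ y, ∀ᵐ x ∂μ, g x ≠ y) {ε : ℝ} (hε : 0 < ε) :
    ∃ δ : ℝ, 0 < δ ∧ ∀ y, ∫ x, tent δ (g x - y) ∂μ ≤ ε := by
  -- otherwise intervals around points `y n`, of lengths tending to zero, carry mass at least
  -- `ε / 2`, and a limit point of the `y n` is an atom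
  by_contra! hcon
  set d : ℕ → ℝ := fun n => 1 / ((n : ℝ) + 1) with hd
  have hd0 : ∀ n, 0 < d n := fun n => by positivity
  have hd1 : ∀ n, d n ≤ 1 := fun n => by
    rw [hd]
    simp only
    rw [div_le_one (by positivity)]
    linarith [n.cast_nonneg (α := ℝ)]
  choose y hy using fun n => hcon (d n) (hd0 n)
  obtain ⟨B, hB⟩ := isCompact_univ.exists_bound_of_continuousOn hg.continuousOn
  have hyB : ∀ n, y n ∈ Icc (-(B + 2)) (B + 2) := by
    intro n
    rw [mem_Icc, ← abs_le]
    by_contra! hlt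
    have : ∫ x, tent (d n) (g x - y n) ∂μ = 0 := by
      refine integral_eq_zero_of_ae (.of_forall fun x => tent_eq_zero (hd0 n) ?_)
      have h1 := hB x (mem_univ x)
      rw [Real.norm_eq_abs] at h1
      have h2 := abs_sub_abs_le_abs_sub (y n) (g x)
      rw [abs_sub_comm] at h2
      linarith [hd1 n]
    linarith [hy n]
  obtain ⟨y₀, -, ψ, hψ, hlim⟩ := isCompact_Icc.tendsto_subseq hyB
  have hdlim : Tendsto (fun n => d (ψ n)) atTop (𝓝 0) :=
    tendsto_one_div_add_atTop_nhds_zero_nat.comp hψ.tendsto_atTop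
  have hzero : Tendsto (fun n => ∫ x, tent (d (ψ n)) (g x - y (ψ n)) ∂μ) atTop
      (𝓝 (∫ _x, (0 : ℝ) ∂μ)) := by
    refine tendsto_integral_of_dominated_convergence (fun _ => 2) (fun n => ?_)
      (integrable_const _) (fun n => .of_forall fun x => ?_) ?_
    · exact ((continuous_tent _).comp (hg.sub continuous_const)).aestronglyMeasurable
    · rw [Real.norm_of_nonneg (tent_nonneg _ _)]; exact tent_le_two (hd0 _) _
    · filter_upwards [hna y₀] with x hx
      have hpos : 0 < |g x - y₀| := abs_pos.2 (sub_ne_zero.2 hx)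
      have h1 : Tendsto (fun n => |g x - y (ψ n)| - 2 * d (ψ n)) atTop (𝓝 (|g x - y₀| - 2 * 0)) :=
        ((tendsto_const_nhds.sub hlim).abs).sub (hdlim.const_mul 2)
      rw [mul_zero, sub_zero] at h1
      refine tendsto_const_nhds.congr' ?_
      filter_upwards [h1.eventually_const_lt hpos] with n hn
      exact (tent_eq_zero (hd0 _) (by linarith)).symm
  rw [integral_zero] at hzero
  obtain ⟨n, hn⟩ := (hzero.eventually_lt_const hε).exists
  linarith [hy (ψ n)]

/-- Adding an independent summand does not increase the concentration function. -/
theorem integral_tent_add_le {M : ℕ} (i : Fin (M + 1)) {X : UnitAddCircle → ℝ}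
    {Y : UnitAddTorus (Fin M) → ℝ} (hX : Continuous X) (hY : Continuous Y) {δ ε : ℝ}
    (hle : ∀ y, ∫ x, tent δ (X x - y) ∂AddCircle.haarAddCircle ≤ ε) (y : ℝ) :
    ∫ ω, tent δ (X (ω i) + Y (fun j => ω (i.succAbove j)) - y) ∂torusMeasure (M + 1) ≤ ε := by
  have hmp := measurePreserving_piFinSuccAbove (α := fun _ : Fin (M + 1) => UnitAddCircle)
    (fun _ => AddCircle.haarAddCircle) i
  have hint : Integrable (fun p : UnitAddCircle × UnitAddTorus (Fin M) =>
      tent δ (X p.1 + Y p.2 - y)) (AddCircle.haarAddCircle.prod (torusMeasure M)) :=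
    ((continuous_tent δ).comp (by fun_prop)).integrable_of_hasCompactSupport
      (HasCompactSupport.of_compactSpace _)
  have h1 := hmp.integral_comp' (g := fun p : UnitAddCircle × UnitAddTorus (Fin M) =>
      tent δ (X p.1 + Y p.2 - y))
  refine (show _ = _ from h1).trans_le ?_
  rw [integral_prod_symm _ hint]
  have h2 : ∀ ω : UnitAddTorus (Fin M),
      ∫ x, tent δ (X x + Y ω - y) ∂AddCircle.haarAddCircle ≤ ε := fun ω => by
    have := hle (y - Y ω)
    simpa only [sub_sub_eq_add_sub, add_sub_assoc, sub_add_eq_add_sub] using this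
  calc ∫ ω, ∫ x, tent δ (X x + Y ω - y) ∂AddCircle.haarAddCircle ∂torusMeasure M
      ≤ ∫ _ω, ε ∂torusMeasure M :=
        integral_mono hint.integral_prod_right (integrable_const _) h2
    _ = ε := by simp

/-- The real linear functionals of the random model have small concentration functions, uniformly
in the number of primes. -/
theorem MemClassM.exists_integral_tent_torusLog_le {E : EulerData} {α β σ₀ : ℝ} {φ : ℂ → ℂ}
    (h : MemClassM E α β σ₀ φ) {n : ℕ} {j : Fin (E.g n)}
    (hj : E.a n j ≠ 0) {s : ℂ} (hs : α + β + 1 / 2 ≤ s.re) {u : ℂ} (hu : u ≠ 0) {ε : ℝ}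
    (hε : 0 < ε) :
    ∃ δ₀ : ℝ, 0 < δ₀ ∧ ∀ δ, 0 < δ → δ ≤ δ₀ → ∀ N > n, ∀ y : ℝ,
      ∫ ω, tent δ ((u * E.torusLog N s ω).re - y) ∂torusMeasure N ≤ ε := by
  have hXc : ∀ m, Continuous fun x : UnitAddCircle =>
      (u * E.localLog m ((prm m : ℂ) ^ (-s) * AddCircle.toCircle x)).re := fun m =>
    continuous_re.comp
      ((h.continuous_localLog_circle m continuous_const (fun _ => hs) continuous_id).const_mul u)
  obtain ⟨δ₀, hδ₀, hle⟩ := exists_forall_integral_tent_le AddCircle.haarAddCircle (hXc n)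
    (h.ae_re_mul_localLog_ne hj hs hu) hε
  refine ⟨δ₀, hδ₀, fun δ hδ hδle N hN y => ?_⟩
  obtain ⟨M, rfl⟩ : ∃ M, N = M + 1 := ⟨N - 1, by omega⟩
  set i : Fin (M + 1) := ⟨n, hN⟩ with hi
  have hsplit : ∀ ω : UnitAddTorus (Fin (M + 1)), (u * E.torusLog (M + 1) s ω).re =
      (u * E.localLog n ((prm n : ℂ) ^ (-s) * AddCircle.toCircle (ω i))).re +
      (∑ k : Fin M, (u * E.localLog (i.succAbove k)
        ((prm (i.succAbove k) : ℂ) ^ (-s) * AddCircle.toCircle (ω (i.succAbove k)))).re) := by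
    intro ω
    rw [EulerData.torusLog, Fin.sum_univ_succAbove _ i, mul_add, add_re, Finset.mul_sum, re_sum]
  simp only [hsplit]
  refine integral_tent_add_le i (hXc n) (Y := fun ω' : UnitAddTorus (Fin M) =>
    ∑ k : Fin M, (u * E.localLog (i.succAbove k)
        ((prm (i.succAbove k) : ℂ) ^ (-s) * AddCircle.toCircle (ω' k))).re)
    (continuous_finsetSum _ fun k _ => (hXc _).comp (continuous_apply k)) (fun y => ?_) y
  refine le_trans (integral_mono_of_nonneg (.of_forall fun x => tent_nonneg _ _) ?_
    (.of_forall fun x => tent_mono hδ hδle _)) (hle y)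
  exact ((continuous_tent _).comp ((hXc n).sub continuous_const)).integrable_of_hasCompactSupport
    (HasCompactSupport.of_compactSpace _)

/-! ### Rectangles, and existence of the limit -/

/-- The indicator of a bounded interval is approximated by a continuous function, with an error
that is stable under shifts by `δ` and lives near the two end points. -/
theorem exists_continuous_approx_indicator {S : Set ℝ} (hS : S.OrdConnected)
    (hb : Bornology.IsBounded S) {δ : ℝ} (hδ : 0 < δ) :
    ∃ (v : ℝ → ℝ) (a b : ℝ), Continuous v ∧ (∀ x, v x ∈ Icc (0 : ℝ) 1) ∧ ∀ x x', |x' - x| ≤ δ →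
      |S.indicator 1 x' - v x| ≤ tent δ (x - a) + tent δ (x - b) := by
  rcases S.eq_empty_or_nonempty with rfl | hne
  · exact ⟨fun _ => 0, 0, 0, continuous_const, fun _ => by simp, fun x x' _ => by
      simpa using add_nonneg (tent_nonneg δ x) (tent_nonneg δ x)⟩
  set a := sInf S with ha
  set b := sSup S with hb'
  have hIoo : ∀ x, a < x → x < b → x ∈ S := fun x h1 h2 => by
    obtain ⟨p, hp, hpx⟩ := exists_lt_of_csInf_lt hne h1
    obtain ⟨q, hq, hqx⟩ := exists_lt_of_lt_csSup hne h2
    exact hS.out hp hq ⟨hpx.le, hqx.le⟩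
  have hIcc : ∀ x ∈ S, a ≤ x ∧ x ≤ b := fun x hx =>
    ⟨csInf_le hb.bddBelow hx, le_csSup hb.bddAbove hx⟩
  set v : ℝ → ℝ := fun x => max 0 (min 1 (1 - max (a - x) (x - b) / δ)) with hv
  have hv01 : ∀ x, v x ∈ Icc (0 : ℝ) 1 := fun x =>
    ⟨le_max_left _ _, max_le zero_le_one (min_le_left _ _)⟩
  have hv1 : ∀ x, a ≤ x → x ≤ b → v x = 1 := fun x h1 h2 => by
    have : max (a - x) (x - b) / δ ≤ 0 :=
      div_nonpos_of_nonpos_of_nonneg (max_le (by linarith) (by linarith)) hδ.le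
    simp only [hv]
    rw [min_eq_left (by linarith), max_eq_right zero_le_one]
  have hv0 : ∀ x, δ ≤ max (a - x) (x - b) → v x = 0 := fun x h1 => by
    have : 1 ≤ max (a - x) (x - b) / δ := (one_le_div hδ).2 h1
    exact max_eq_left ((min_le_right _ _).trans (by linarith))
  refine ⟨v, a, b, by fun_prop, hv01, fun x x' hx => ?_⟩
  obtain ⟨hx1, hx2⟩ := abs_le.1 hx
  have t1 := tent_nonneg δ (x - a)
  have t2 := tent_nonneg δ (x - b)
  -- either the two values agree, or `x` is within `δ` of an end point
  have hnear : |x - a| ≤ δ ∨ |x - b| ≤ δ ∨ S.indicator 1 x' = v x := by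
    by_cases hxS : x' ∈ S
    · obtain ⟨h1, h2⟩ := hIcc x' hxS
      rw [indicator_of_mem hxS, Pi.one_apply]
      by_cases hxa : a ≤ x
      · by_cases hxb : x ≤ b
        · exact Or.inr (Or.inr (hv1 x hxa hxb).symm)
        · exact Or.inr (Or.inl (abs_le.2 ⟨by linarith, by linarith⟩))
      · exact Or.inl (abs_le.2 ⟨by linarith, by linarith⟩)
    · rw [indicator_of_notMem hxS]
      have hout : x' ≤ a ∨ b ≤ x' := by
        by_contra! hcon
        exact hxS (hIoo x' hcon.1 hcon.2)
      by_cases hfar : δ ≤ max (a - x) (x - b)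
      · exact Or.inr (Or.inr (hv0 x hfar).symm)
      · rw [not_le, max_lt_iff] at hfar
        rcases hout with h1 | h1
        · exact Or.inl (abs_le.2 ⟨by linarith [hfar.1], by linarith⟩)
        · exact Or.inr (Or.inl (abs_le.2 ⟨by linarith, by linarith [hfar.2]⟩))
  have hle1 : |S.indicator 1 x' - v x| ≤ 1 := by
    obtain ⟨h1, h2⟩ := hv01 x
    by_cases hxS : x' ∈ S
    · rw [indicator_of_mem hxS, Pi.one_apply, abs_le]; constructor <;> linarith
    · rw [indicator_of_notMem hxS, abs_le]; constructor <;> linarith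
  rcases hnear with h1 | h1 | h1
  · linarith [one_le_tent hδ h1]
  · linarith [one_le_tent hδ h1]
  · rw [h1, sub_self, abs_zero]; linarith

/-- The error function for the approximation of the indicator of a rectangle: a sum of bumps along
the four lines that carry its sides. -/
def frame (δ a₁ b₁ a₂ b₂ : ℝ) (z : ℂ) : ℝ :=
  (tent δ (z.re - a₁) + tent δ (z.re - b₁)) + (tent δ (z.im - a₂) + tent δ (z.im - b₂))

theorem continuous_frame (δ a₁ b₁ a₂ b₂ : ℝ) : Continuous (frame δ a₁ b₁ a₂ b₂) := by
  have := continuous_tent δ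
  unfold frame
  fun_prop

theorem frame_nonneg (δ a₁ b₁ a₂ b₂ : ℝ) (z : ℂ) : 0 ≤ frame δ a₁ b₁ a₂ b₂ z :=
  add_nonneg (add_nonneg (tent_nonneg _ _) (tent_nonneg _ _))
    (add_nonneg (tent_nonneg _ _) (tent_nonneg _ _))

/-- The indicator of a rectangle is approximated by a continuous function, with an error that is
stable under shifts by `δ` and lives near the lines that carry the sides. -/
theorem exists_continuous_approx_rectangle {R : Set ℂ} (hR : IsRectangle R) {δ : ℝ} (hδ : 0 < δ) :
    ∃ (v : ℂ → ℝ) (a₁ b₁ a₂ b₂ : ℝ), Continuous v ∧ (∀ z, v z ∈ Icc (0 : ℝ) 1) ∧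
      ∀ z w : ℂ, ‖w - z‖ ≤ δ → |R.indicator 1 w - v z| ≤ frame δ a₁ b₁ a₂ b₂ z := by
  obtain ⟨S₁, S₂, hS₁, hS₂, hb₁, hb₂, rfl⟩ := hR
  obtain ⟨v₁, a₁, b₁, hc₁, h01₁, hv₁⟩ := exists_continuous_approx_indicator hS₁ hb₁ hδ
  obtain ⟨v₂, a₂, b₂, hc₂, h01₂, hv₂⟩ := exists_continuous_approx_indicator hS₂ hb₂ hδ
  refine ⟨fun z => v₁ z.re * v₂ z.im, a₁, b₁, a₂, b₂, by fun_prop, fun z =>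
    ⟨mul_nonneg (h01₁ _).1 (h01₂ _).1, mul_le_one₀ (h01₁ _).2 (h01₂ _).1 (h01₂ _).2⟩,
    fun z w hzw => ?_⟩
  have hprod : (S₁ ×ℂ S₂).indicator (1 : ℂ → ℝ) w = S₁.indicator 1 w.re * S₂.indicator 1 w.im := by
    by_cases h1 : w.re ∈ S₁ <;> by_cases h2 : w.im ∈ S₂ <;>
      simp [indicator, mem_reProdIm, h1, h2]
  have e1 := hv₁ z.re w.re (by rw [← sub_re]; exact (abs_re_le_norm _).trans hzw)
  have e2 := hv₂ z.im w.im (by rw [← sub_im]; exact (abs_im_le_norm _).trans hzw)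
  have hi : |S₁.indicator (1 : ℝ → ℝ) w.re| ≤ 1 := by
    by_cases h1 : w.re ∈ S₁ <;> simp [h1]
  have hv : |v₂ z.im| ≤ 1 := abs_le.2 ⟨by linarith [(h01₂ z.im).1], (h01₂ z.im).2⟩
  rw [hprod, show S₁.indicator (1 : ℝ → ℝ) w.re * S₂.indicator 1 w.im - v₁ z.re * v₂ z.im =
    (S₁.indicator 1 w.re - v₁ z.re) * v₂ z.im +
      S₁.indicator 1 w.re * (S₂.indicator 1 w.im - v₂ z.im) by ring, frame]
  refine (abs_add_le _ _).trans (add_le_add ?_ ?_)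
  · rw [abs_mul]
    exact (mul_le_of_le_one_right (abs_nonneg _) hv).trans e1
  · rw [abs_mul]
    exact (mul_le_of_le_one_left (abs_nonneg _) hi).trans e2

/-- The Cauchy criterion in terms of approximate limits. -/
theorem exists_tendsto_of_forall_eventually_near {v : ℝ → ℝ}
    (h : ∀ ε > 0, ∃ c, ∀ᶠ T in atTop, |v T - c| ≤ ε) : ∃ W, Tendsto v atTop (𝓝 W) := by
  rw [← cauchy_map_iff_exists_tendsto, Metric.cauchy_iff]
  refine ⟨inferInstance, fun ε hε => ?_⟩
  obtain ⟨c, hc⟩ := h (ε / 3) (by positivity)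
  refine ⟨_, image_mem_map hc, ?_⟩
  rintro _ ⟨T, hT, rfl⟩ _ ⟨T', hT', rfl⟩
  have h1 : |v T - c| ≤ ε / 3 := hT
  have h2 : |v T' - c| ≤ ε / 3 := hT'
  rw [Real.dist_eq]
  have h3 := abs_sub_le (v T) c (v T')
  rw [abs_sub_comm c] at h3
  linarith

/-- Comparison of the (outer) measure of a set `P ⊆ [-T, T]` with the integral of a continuous
function that approximates its indicator up to an error `k`, off an exceptional set `Q`. -/
theorem abs_measure_window_sub_integral_le {P Q : ℝ → Prop} {v k : ℝ → ℝ} (hv : Continuous v)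
    (hk : Continuous k) (hv01 : ∀ t, v t ∈ Icc (0 : ℝ) 1) (hk0 : ∀ t, 0 ≤ k t)
    (hP : ∀ t, ¬Q t → P t → 1 ≤ v t + k t) (hnP : ∀ t, ¬Q t → ¬P t → v t ≤ k t) {T : ℝ}
    (hT : 0 ≤ T) :
    |volume.real {t : ℝ | t ∈ Icc (-T) T ∧ P t} - ∫ t in (-T)..T, v t| ≤
      volume.real {t : ℝ | t ∈ Icc (-T) T ∧ Q t} + ∫ t in (-T)..T, k t := by
  have hvi := hv.intervalIntegrable (μ := volume) (-T) T
  have hki := hk.intervalIntegrable (μ := volume) (-T) T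
  have hcover : ∀ {A B C : ℝ → Prop}, (∀ t, A t → B t ∨ C t) →
      volume.real {t : ℝ | t ∈ Icc (-T) T ∧ A t} ≤
        volume.real {t : ℝ | t ∈ Icc (-T) T ∧ B t} +
          volume.real {t : ℝ | t ∈ Icc (-T) T ∧ C t} := by
    intro A B C hABC
    refine le_trans (measureReal_mono ?_ ?_) (measureReal_union_le _ _)
    · rintro t ⟨ht, hA⟩
      exact (hABC t hA).imp (fun hB => ⟨ht, hB⟩) fun hC => ⟨ht, hC⟩
    · exact (measure_union_lt_top (measure_window_ne_top T _).lt_top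
        (measure_window_ne_top T _).lt_top).ne
  have hup : volume.real {t : ℝ | t ∈ Icc (-T) T ∧ 1 ≤ v t + k t} ≤
      (∫ t in (-T)..T, v t) + ∫ t in (-T)..T, k t := by
    have := measure_window_le_of_integral_le (k := fun t => v t + k t) (hv.add hk)
      (fun t => add_nonneg (hv01 t).1 (hk0 t)) hT one_pos
      (intervalIntegral.integral_add hvi hki).le
    simpa using this
  have hlow : volume.real {t : ℝ | t ∈ Icc (-T) T ∧ v t ≤ k t} ≤
      2 * T - (∫ t in (-T)..T, v t) + ∫ t in (-T)..T, k t := by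
    have h1 : ∫ t in (-T)..T, (1 - v t + k t) ≤
        2 * T - (∫ t in (-T)..T, v t) + ∫ t in (-T)..T, k t := by
      rw [intervalIntegral.integral_add ((intervalIntegrable_const).sub hvi) hki,
        intervalIntegral.integral_sub intervalIntegrable_const hvi]
      simp
      linarith
    have := measure_window_le_of_integral_le (k := fun t => 1 - v t + k t)
      ((continuous_const.sub hv).add hk)
      (fun t => add_nonneg (by linarith [(hv01 t).2]) (hk0 t)) hT one_pos h1
    rw [div_one] at this
    refine le_trans (measureReal_mono ?_ (measure_window_ne_top T _)) this
    exact fun t ht => ⟨ht.1, by linarith [ht.2]⟩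
  have hall : volume.real {t : ℝ | t ∈ Icc (-T) T ∧ True} = 2 * T := by
    have : {t : ℝ | t ∈ Icc (-T) T ∧ True} = Icc (-T) T := by ext t; simp
    rw [this, Real.volume_real_Icc, max_eq_left (by linarith)]
    ring
  have e1 := hcover (A := P) (B := Q) (C := fun t => 1 ≤ v t + k t) fun t hPt => by
    by_cases hQ : Q t
    · exact Or.inl hQ
    · exact Or.inr (hP t hQ hPt)
  have e2 := hcover (A := fun _ => True) (B := P) (C := fun t => Q t ∨ v t ≤ k t) fun t _ => by
    by_cases hPt : P t
    · exact Or.inl hPt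
    · by_cases hQ : Q t
      · exact Or.inr (Or.inl hQ)
      · exact Or.inr (Or.inr (hnP t hQ hPt))
  have e3 := hcover (A := fun t => Q t ∨ v t ≤ k t) fun t h => h
  rw [hall] at e2
  rw [abs_le]
  constructor <;> linarith

namespace MemClassM

variable {E : EulerData} {α β σ₀ : ℝ} {φ : ℂ → ℂ}

/-- The neighbourhoods of four lines have small probability in the random model if each real and
imaginary part has a small concentration function; the imaginary part is `Re (-i w)`. -/
theorem integral_frame_torusLog_le (h : MemClassM E α β σ₀ φ) {N : ℕ} {s : ℂ}
    (hs : α + β + 1 / 2 ≤ s.re) {δ ε : ℝ}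
    (hre : ∀ y, ∫ ω, tent δ ((1 * E.torusLog N s ω).re - y) ∂torusMeasure N ≤ ε)
    (him : ∀ y, ∫ ω, tent δ ((-I * E.torusLog N s ω).re - y) ∂torusMeasure N ≤ ε)
    (a₁ b₁ a₂ b₂ : ℝ) :
    ∫ ω, frame δ a₁ b₁ a₂ b₂ (E.torusLog N s ω) ∂torusMeasure N ≤ 4 * ε := by
  have hc : Continuous (E.torusLog N s) :=
    h.continuous_torusLog N continuous_const (fun _ => hs) continuous_id
  have hci : ∀ f : UnitAddTorus (Fin N) → ℝ, Continuous f → Integrable f (torusMeasure N) :=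
    fun f hf => hf.integrable_of_hasCompactSupport (HasCompactSupport.of_compactSpace _)
  have ht := continuous_tent δ
  have hr : ∀ y, Integrable (fun ω => tent δ ((E.torusLog N s ω).re - y)) (torusMeasure N) :=
    fun y => hci _ (by fun_prop)
  have hi : ∀ y, Integrable (fun ω => tent δ ((E.torusLog N s ω).im - y)) (torusMeasure N) :=
    fun y => hci _ (by fun_prop)
  have hmul : ∀ w : ℂ, (-I * w).re = w.im := fun w => by simp
  simp only [one_mul] at hre
  simp only [hmul] at him
  unfold frame
  have e1 := integral_add (hr a₁) (hr b₁)
  have e2 := integral_add (hi a₂) (hi b₂)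
  have e3 := integral_add ((hr a₁).add (hr b₁)) ((hi a₂).add (hi b₂))
  simp only [Pi.add_apply] at e3
  rw [e3, e1, e2]
  linarith [hre a₁, hre b₁, him a₂, him b₂]

/-- If some local factor is nontrivial, `V_σ(T, R; φ) / 2T` is eventually close to a mean value over
the torus. -/
theorem exists_eventually_abs_mean_sub_le (h : MemClassM E α β σ₀ φ) {σ : ℝ} (hσ : σ₀ < σ)
    {n : ℕ} {j : Fin (E.g n)} (hj : E.a n j ≠ 0) {R : Set ℂ} (hR : IsRectangle R) {ε : ℝ}
    (hε : 0 < ε) :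
    ∃ c, ∀ᶠ T : ℝ in atTop, |1 / (2 * T) * V E α β σ₀ φ σ T R - c| ≤ ε := by
  have hle := h.le_sigma
  have hs : α + β + 1 / 2 ≤ (σ : ℂ).re := by rw [ofReal_re]; linarith
  obtain ⟨δ₁, hδ₁, H₁⟩ := h.exists_integral_tent_torusLog_le hj hs (u := 1) one_ne_zero
    (ε := ε / 16) (by positivity)
  obtain ⟨δ₂, hδ₂, H₂⟩ := h.exists_integral_tent_torusLog_le hj hs (u := -I)
    (neg_ne_zero.2 I_ne_zero) (ε := ε / 16) (by positivity)
  set δ := min δ₁ δ₂ with hδdef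
  have hδ : 0 < δ := lt_min hδ₁ hδ₂
  obtain ⟨N₀, hN₀⟩ := h.exists_forall_rare_not_close hσ hδ (half_pos hε)
  -- the nontrivial local factor has to occur in the partial sum
  set N := max N₀ (n + 1) with hN
  have hNn : n < N := Nat.lt_of_succ_le (le_max_right _ _)
  have hrare := hN₀ N (le_max_left _ _)
  obtain ⟨v, a₁, b₁, a₂, b₂, hv, hv01, hvR⟩ := exists_continuous_approx_rectangle hR hδ
  have hc : Continuous (E.torusLog N σ) :=
    h.continuous_torusLog N continuous_const (fun _ => hs) continuous_id
  have hframe := h.integral_frame_torusLog_le hs (H₁ δ hδ (min_le_left _ _) N hNn)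
    (H₂ δ hδ (min_le_right _ _) N hNn) a₁ b₁ a₂ b₂
  have hkc := (continuous_frame δ a₁ b₁ a₂ b₂).comp hc
  have hvc := hv.comp hc
  have hmean_k := (tendsto_mean_flow hkc).eventually_lt_const
    (show _ < 3 * ε / 8 by simp only [Function.comp_apply]; linarith)
  have hmean_v := (tendsto_mean_flow hvc).eventually (Metric.closedBall_mem_nhds _
    (show 0 < ε / 8 by positivity))
  refine ⟨∫ ω, (v ∘ E.torusLog N σ) ω ∂torusMeasure N, ?_⟩
  filter_upwards [hmean_k, hmean_v, hrare, eventually_gt_atTop 0] with T hk hv' hr hT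
  rw [Real.dist_eq] at hv'
  have hflow := continuous_flow N
  have hcomp := abs_measure_window_sub_integral_le (T := T)
    (P := fun t => (σ + t * I : ℂ) ∈ cutDomain σ₀ φ ∧ logPhi E (α + β + 1) (σ + t * I) ∈ R)
    (Q := fun t => ¬((σ + t * I : ℂ) ∈ cutDomain σ₀ φ ∧
        ‖logPhi E (α + β + 1) (σ + t * I) - E.partialLog N (σ + t * I)‖ ≤ δ))
    (hvc.comp hflow) (hkc.comp hflow) (fun t => hv01 _) (fun t => frame_nonneg _ _ _ _ _ _)
    (fun t hQ hP => by
      obtain ⟨-, hclose⟩ := not_not.1 hQ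
      rw [← torusLog_flow] at hclose
      have := hvR _ _ hclose
      rw [indicator_of_mem hP.2, Pi.one_apply] at this
      have := (abs_le.1 this).2
      simp only [Function.comp_apply]
      linarith)
    (fun t hQ hP => by
      obtain ⟨hdom, hclose⟩ := not_not.1 hQ
      rw [← torusLog_flow] at hclose
      have := hvR _ _ hclose
      rw [indicator_of_notMem fun hmem => hP ⟨hdom, hmem⟩] at this
      have := (abs_le.1 this).1
      simp only [Function.comp_apply]
      linarith) hT.le
  have h2T : 0 < 1 / (2 * T) := by positivity
  have hT1 : 1 / (2 * T) * (ε / 2 * T) = ε / 4 := by field_simp; norm_num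
  have hbound : |1 / (2 * T) * V E α β σ₀ φ σ T R -
      1 / (2 * T) * ∫ t in (-T)..T, (v ∘ E.torusLog N σ) (flow N t)| ≤ ε / 4 + 3 * ε / 8 := by
    rw [← mul_sub, abs_mul, abs_of_pos h2T]
    calc _ ≤ 1 / (2 * T) * (ε / 2 * T +
          ∫ t in (-T)..T, (frame δ a₁ b₁ a₂ b₂ ∘ E.torusLog N σ) (flow N t)) := by
          refine mul_le_mul_of_nonneg_left (hcomp.trans ?_) h2T.le
          exact add_le_add hr le_rfl
      _ ≤ ε / 4 + 3 * ε / 8 := by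
          rw [mul_add, hT1]
          linarith
  have := abs_sub_le (1 / (2 * T) * V E α β σ₀ φ σ T R)
    (1 / (2 * T) * ∫ t in (-T)..T, (v ∘ E.torusLog N σ) (flow N t))
    (∫ ω, (v ∘ E.torusLog N σ) ω ∂torusMeasure N)
  linarith

/-- If all local factors are trivial, then `log φ = 0` and the limit distribution is the unit mass
at `0`. -/
theorem tendsto_mean_of_forall_eq_zero (h : MemClassM E α β σ₀ φ) {σ : ℝ} (hσ : σ₀ < σ)
    (ha : ∀ n j, E.a n j = 0) (R : Set ℂ) :
    ∃ W, Tendsto (fun T : ℝ => 1 / (2 * T) * V E α β σ₀ φ σ T R) atTop (𝓝 W) := by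
  have hlog : ∀ s, E.eulerLog s = 0 := fun s => by simp [EulerData.eulerLog, ha]
  have hphi : ∀ s, logPhi E (α + β + 1) s = 0 := fun s =>
    logPhi_eq ⟨fun _ => 0, fun _ _ => analyticAt_const, fun z _ _ => (hlog z).symm, rfl⟩
  refine exists_tendsto_of_forall_eventually_near fun ε hε => ⟨R.indicator 1 0, ?_⟩
  obtain ⟨N₀, hN₀⟩ := h.exists_forall_rare_not_close hσ one_pos hε
  filter_upwards [hN₀ N₀ le_rfl, eventually_gt_atTop 0] with T hr hT
  have hcomp := abs_measure_window_sub_integral_le (T := T)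
    (P := fun t => (σ + t * I : ℂ) ∈ cutDomain σ₀ φ ∧ logPhi E (α + β + 1) (σ + t * I) ∈ R)
    (Q := fun t => ¬((σ + t * I : ℂ) ∈ cutDomain σ₀ φ ∧
        ‖logPhi E (α + β + 1) (σ + t * I) - E.partialLog N₀ (σ + t * I)‖ ≤ 1))
    (v := fun _ => R.indicator 1 0) (k := fun _ => 0)
    continuous_const continuous_const
    (fun t => by by_cases h0 : (0 : ℂ) ∈ R <;> simp [h0]) (fun t => le_rfl)
    (fun t _ hP => by
      rw [hphi] at hP
      simp [hP.2])
    (fun t hQ hP => by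
      rw [hphi] at hP
      rw [indicator_of_notMem fun h0 => hP ⟨(not_not.1 hQ).1, h0⟩]) hT.le
  simp only [intervalIntegral.integral_const, smul_eq_mul, mul_zero, add_zero] at hcomp
  have h2T : 0 < 1 / (2 * T) := by positivity
  have e1 : 1 / (2 * T) * V E α β σ₀ φ σ T R - R.indicator (1 : ℂ → ℝ) 0 =
      1 / (2 * T) * (V E α β σ₀ φ σ T R - (T - -T) * R.indicator (1 : ℂ → ℝ) 0) := by
    field_simp; ring
  rw [e1, abs_mul, abs_of_pos h2T]
  calc _ ≤ 1 / (2 * T) * (ε * T) := mul_le_mul_of_nonneg_left (hcomp.trans hr) h2T.le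
    _ = ε / 2 := by field_simp
    _ ≤ ε := by linarith

end MemClassM

end EulerLimit

end

theorem theorem3p1 (E : EulerLimit.EulerData) (α β σ₀ : ℝ) (φ : ℂ → ℂ)
    (hφ : EulerLimit.MemClassM E α β σ₀ φ) (σ : ℝ) (hσ : σ₀ < σ)
    (R : Set ℂ) (hR : EulerLimit.IsRectangle R) :
    ∃ W : ℝ, Tendsto (fun T : ℝ => 1 / (2 * T) * EulerLimit.V E α β σ₀ φ σ T R)
      atTop (𝓝 W) := by
  by_cases ha : ∀ n j, E.a n j = 0
  · exact hφ.tendsto_mean_of_forall_eq_zero hσ ha R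
  · push Not at ha
    obtain ⟨n, j, hj⟩ := ha
    exact EulerLimit.exists_tendsto_of_forall_eventually_near fun ε hε =>
      hφ.exists_eventually_abs_mean_sub_le hσ hj hR hε
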